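/- Let $m,K\in\mathbb N$ and $T>0$. On $[0,T]$ let $H(t)\in\mathbb C^{m\times m}$ be Hermitian and $\gamma_1(t),\dots,\gamma_K(t)\ge 0$, all twice continuously differentiable in $t$, let $L_1,\dots,L_K\in\mathbb C^{m\times m}$, and put $A(t)=-iH(t)-\frac12\sum_{k}\gamma_k(t)L_k^\dagger L_k$. Let $\rho$ solve the forward Lindblad equation $$\dot\rho(t)=A(t)\rho(t)+\rho(t)A(t)^\dagger+\sum_{k=1}^K\gamma_k(t)L_k\rho(t)L_k^\dagger,\quad t\in[0,T],\qquad \rho(0)=\rho_0,$$ where $\rho_0$ is Hermitian positive semidefinite with unit trace. Let $N\ge1$, $\tau=T/N$, $t_\nu=\nu\tau$, $A_\nu=A(t_\nu)$. Write $\|\cdot\|_1$ for the trace norm, $\|\cdot\|_F$ for the Frobenius norm and $\sigma_1\ge\sigma_2\ge\cdots$ for singular values. For $\varepsilon_1>0$ and $X\in\mathbb C^{m\times s}$, let $\mathcal T_{\varepsilon_1}(X)$ denote a best rank-$r$ approximation $B$ of $X$ in the Frobenius norm, where $r$ is the least integer with $\sum_{j=r+1}^s\sigma_j(X)^2\le\varepsilon_1$;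 it may be given by any factor $Y$ with $YY^\dagger=BB^\dagger$ (for example with $r$ columns). Let matrices $\mathfrak e^{\mu\tau A_\nu}$ approximate the matrix exponentials with tolerance $\varepsilon_2>0$: for some $C_e>0$, $$\|e^{\mu\tau A_\nu}\sigma e^{\mu\tau A_\nu^\dagger}-\mathfrak e^{\mu\tau A_\nu}\sigma(\mathfrak e^{\mu\tau A_\nu})^\dagger\|_1\le C_e\varepsilon_2\|\sigma\|_1\qquad(\mu\in\{\tfrac12,1\},\ \nu\in\{n,n+\tfrac12\},\ 0\le n\le N-1,\ \sigma\in\mathbb C^{m\times m}).$$ Given $X_0\in\mathbb C^{m\times r_0}$ with $\operatorname{Tr}(X_0X_0^\dagger)=1$, the normalized low-rank exponential midpoint (LREM) scheme is, for $n=0,\dots,N-1$, $$G_n=\mathcal T_{\varepsilon_1}\big([\sqrt{\tau\gamma_1(t_n)}L_1X_n,\dots,\sqrt{\tau\gamma_K(t_n)}L_KX_n]\big),\qquad X_{n+1/2}=\mathcal T_{\varepsilon_1}\big(\mathfrak e^{\frac\tau2A_n}[X_n,\sqrt{0.5}\,G_n]\big),$$ $$G_{n+1/2}=\mathcal T_{\varepsilon_1}\big([\sqrt{\tau\gamma_1(t_{n+1/2})}L_1X_{n+1/2},\dots,\sqrt{\tau\gamma_K(t_{n+1/2})}L_KX_{n+1/2}]\big),$$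 $$\hat X_{n+1}=\mathcal T_{\varepsilon_1}\big([\mathfrak e^{\tau A_{n+1/2}}X_n,\ \mathfrak e^{\frac\tau2A_{n+1/2}}G_{n+1/2}]\big),\qquad X_{n+1}=\hat X_{n+1}/\|\hat X_{n+1}\|_F$$ (with $X_{n+1}=0$ if $\hat X_{n+1}=0$), and $\varrho_n=X_nX_n^\dagger$. Its tolerances are $\varepsilon_1=\tau\epsilon_1$ and $\varepsilon_2=\tau\epsilon_2$ with $\epsilon_1,\epsilon_2>0$, and $\|\rho_0-\varrho_0\|_1\le\delta$. Put $C_2=\sum_{k=1}^K\big(\max_{[0,T]}\gamma_k\big)\|L_k\|_1^2$. There is a constant $C_1>0$, depending only on $m$, $K$, $H$, $L_k$, $\gamma_k$ and $T$, such that the full-rank exponential midpoint map $$\Phi(t_n,\sigma)=e^{\tau A_{n+1/2}}\sigma e^{\tau A_{n+1/2}^\dagger}+\tau\sum_{k}\gamma_k(t_{n+1/2})e^{\frac\tau2A_{n+1/2}}L_k\sigma_{n+1/2}L_k^\dagger e^{\frac\tau2A_{n+1/2}^\dagger},\qquad \sigma_{n+1/2}=e^{\frac\tau2A_n}\Big(\sigma+\frac\tau2\sum_k\gamma_k(t_n)L_k\sigma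 L_k^\dagger\Big)e^{\frac\tau2A_n^\dagger},$$ satisfies $\|\rho(t_{n+1})-\Phi(t_n,\rho(t_n))\|_1\le C_1\tau^3$ for all $0\le n\le N-1$ (for all such $\rho$ and $N$), and such that $$\|\rho(t_n)-\varrho_n\|_1\le c_1\tau^2+c_2\delta+c_3\epsilon_1+c_4\epsilon_2,\qquad 0\le n\le N,$$ with positive constants $c_1,c_2,c_3,c_4$ that depend only on $C_1,C_2,C_e,T$ and are independent of $\tau,n,\delta,\epsilon_1,\epsilon_2$. -/

import Mathlib

open scoped Matrix ComplexOrder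

noncomputable section

namespace Lindblad

/-! ### Matrix norms and truncated singular value decompositions -/

section Norms

open scoped Matrix.Norms.Frobenius

/-- The Frobenius norm of a complex matrix. -/
def frobNorm {ι κ : Type*} [Fintype ι] [Fintype κ] (X : Matrix ι κ ℂ) : ℝ := ‖X‖

end Norms

/-- The `j`-th largest singular value of a matrix, counted from `j = 0`
(it is zero from the number of columns on). -/
def singVal {ι κ : Type*} [Fintype ι] [DecidableEq ι] [Fintype κ] [DecidableEq κ]
    (X : Matrix ι κ ℂ) (j : ℕ) : ℝ :=
  (Matrix.toEuclideanLin X).singularValues j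

/-- The trace norm of a square matrix: the sum of its `m` singular values. -/
def traceNorm {m : ℕ} (A : Matrix (Fin m) (Fin m) ℂ) : ℝ :=
  ∑ j ∈ Finset.range m, singVal A j

/-- `B` is a best approximation of `X` in the Frobenius norm
among the matrices of rank at most `r`. -/
def IsBestRankApprox {ι κ : Type*} [Fintype ι] [Fintype κ]
    (r : ℕ) (X B : Matrix ι κ ℂ) : Prop :=
  B.rank ≤ r ∧ ∀ C : Matrix ι κ ℂ, C.rank ≤ r → frobNorm (X - B) ≤ frobNorm (X - C)

/-- `r` is the least natural number for which the squares of the singular values of `X`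
beyond the first `r` ones sum up to at most `ε`. -/
def IsTruncationRank {ι κ : Type*} [Fintype ι] [DecidableEq ι] [Fintype κ] [DecidableEq κ]
    (ε : ℝ) (X : Matrix ι κ ℂ) (r : ℕ) : Prop :=
  IsLeast {r : ℕ | ∑ j ∈ Finset.Ico r (Fintype.card κ), singVal X j ^ 2 ≤ ε} r

/-- `Y` is a truncated singular value decomposition of `X` with tolerance `ε`: it represents a
best rank `r` approximation `B` of `X`, where `r` is the truncation rank. As `B` need not be
unique, this is a relation. As the columns are to be compressed, `Y` is `B` itself
or any other factor of `B Bᴴ`, such as the matrix `U_r Σ_r` with `r` columns. -/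
def IsTruncatedSVD {ι κ κ' : Type*} [Fintype ι] [DecidableEq ι] [Fintype κ] [DecidableEq κ]
    [Fintype κ'] (ε : ℝ) (X : Matrix ι κ ℂ) (Y : Matrix ι κ' ℂ) : Prop :=
  ∃ (r : ℕ) (B : Matrix ι κ ℂ),
    IsTruncationRank ε X r ∧ IsBestRankApprox r X B ∧ Y * Yᴴ = B * Bᴴ

/-! ### The Lindblad equation -/

/-- A density matrix: Hermitian positive semidefinite with unit trace. -/
def IsDensity {m : ℕ} (ρ : Matrix (Fin m) (Fin m) ℂ) : Prop :=
  ρ.PosSemidef ∧ ρ.trace = 1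

/-- The coefficients of a Lindblad equation on `m × m` matrices with `K` channels:
the Hamiltonian, the jump operators, and the decay parameters. -/
structure System (m K : ℕ) where
  H : ℝ → Matrix (Fin m) (Fin m) ℂ
  L : Fin K → Matrix (Fin m) (Fin m) ℂ
  γ : Fin K → ℝ → ℝ

namespace System

variable {m K : ℕ} (S : System m K)

/-- The standing assumptions on the coefficients on `[0, T]`: the Hamiltonian is Hermitian, the
decay parameters are nonnegative, and both are twice continuously differentiable in time. -/
structure Admissible (T : ℝ) : Prop where
  isHermitian : ∀ t ∈ Set.Icc 0 T, (S.H t).IsHermitian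
  nonneg : ∀ k, ∀ t ∈ Set.Icc 0 T, 0 ≤ S.γ k t
  contDiffOn_H : ∀ i j, ContDiffOn ℝ 2 (fun t => S.H t i j) (Set.Icc 0 T)
  contDiffOn_γ : ∀ k, ContDiffOn ℝ 2 (S.γ k) (Set.Icc 0 T)

/-- `A(t) = -i H(t) - ½ ∑ₖ γₖ(t) Lₖᴴ Lₖ`. -/
def A (t : ℝ) : Matrix (Fin m) (Fin m) ℂ :=
  -(Complex.I • S.H t) - (1 / 2 : ℝ) • ∑ k, S.γ k t • ((S.L k)ᴴ * S.L k)

/-- `∑ₖ γₖ(t) Lₖ ρ Lₖᴴ`. -/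
def jump (t : ℝ) (ρ : Matrix (Fin m) (Fin m) ℂ) : Matrix (Fin m) (Fin m) ℂ :=
  ∑ k, S.γ k t • (S.L k * ρ * (S.L k)ᴴ)

/-- `ρ` solves the forward Lindblad equation on `[0, T]` with initial value `ρ₀`
(one-sided derivatives at the end points). -/
def IsSolution (T : ℝ) (ρ₀ : Matrix (Fin m) (Fin m) ℂ)
    (ρ : ℝ → Matrix (Fin m) (Fin m) ℂ) : Prop :=
  ρ 0 = ρ₀ ∧ ∀ t ∈ Set.Icc 0 T,
    HasDerivWithinAt ρ (S.A t * ρ t + ρ t * (S.A t)ᴴ + S.jump t (ρ t)) (Set.Icc 0 T) t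

/-- The constant `C₂ = ∑ₖ (max_{0 ≤ t ≤ T} γₖ(t)) ‖Lₖ‖₁²`. -/
def C₂ (T : ℝ) : ℝ :=
  ∑ k, sSup (S.γ k '' Set.Icc 0 T) * traceNorm (S.L k) ^ 2

/-! ### The full-rank exponential midpoint scheme -/

/-- The half step from `t` to `t + τ / 2` of the full-rank exponential midpoint scheme. -/
def halfStep (τ t : ℝ) (ρ : Matrix (Fin m) (Fin m) ℂ) : Matrix (Fin m) (Fin m) ℂ :=
  NormedSpace.exp ((τ / 2) • S.A t) * (ρ + (τ / 2) • S.jump t ρ) *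
    NormedSpace.exp ((τ / 2) • (S.A t)ᴴ)

/-- The unnormalized full-rank exponential midpoint step `Φ(t, ρ)` of size `τ`. -/
def Φ (τ t : ℝ) (ρ : Matrix (Fin m) (Fin m) ℂ) : Matrix (Fin m) (Fin m) ℂ :=
  NormedSpace.exp (τ • S.A (t + τ / 2)) * ρ * NormedSpace.exp (τ • (S.A (t + τ / 2))ᴴ) +
    τ • (NormedSpace.exp ((τ / 2) • S.A (t + τ / 2)) *
      S.jump (t + τ / 2) (S.halfStep τ t ρ) *
      NormedSpace.exp ((τ / 2) • (S.A (t + τ / 2))ᴴ))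

/-- `C₁` bounds the truncation errors of the full-rank exponential midpoint scheme: for every
solution `ρ` on `[0, T]` that starts from a density matrix and every uniform grid `tₙ = n τ`,
`τ = T / N`, one has `‖ρ(tₙ₊₁) - Φ(tₙ, ρ(tₙ))‖₁ ≤ C₁ τ³` for `0 ≤ n ≤ N - 1`. -/
def IsTruncationConstant (T C₁ : ℝ) : Prop :=
  ∀ (ρ₀ : Matrix (Fin m) (Fin m) ℂ) (ρ : ℝ → Matrix (Fin m) (Fin m) ℂ),
    IsDensity ρ₀ → S.IsSolution T ρ₀ ρ →
    ∀ (N : ℕ) (τ : ℝ), 0 < N → τ = T / N → ∀ n < N,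
      traceNorm (ρ ((n + 1) * τ) - S.Φ τ (n * τ) (ρ (n * τ))) ≤ C₁ * τ ^ 3

/-! ### The low-rank exponential midpoint scheme -/

/-- The matrices `√(τ γₖ(t)) Lₖ X`, `k = 1, …, K`, placed side by side. -/
def channelFactor {κ : Type*} (τ t : ℝ) (X : Matrix (Fin m) κ ℂ) :
    Matrix (Fin m) (Fin K × κ) ℂ :=
  Matrix.of fun i p => (√(τ * S.γ p.1 t) • (S.L p.1 * X)) i p.2

/-- `e s t` approximates `exp (s A(t))`: for `μ = 1/2, 1` and `ν = n, n + 1/2`, `n < N`,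
`‖exp(μτA_ν) σ exp(μτA_νᴴ) - e(μτ, ντ) σ e(μτ, ντ)ᴴ‖₁ ≤ Cₑ ε₂ ‖σ‖₁` for every matrix `σ`. -/
def IsExpApprox (τ : ℝ) (N : ℕ) (Ce ε₂ : ℝ) (e : ℝ → ℝ → Matrix (Fin m) (Fin m) ℂ) : Prop :=
  ∀ n < N, ∀ μ ∈ ({1 / 2, 1} : Set ℝ), ∀ ν ∈ ({(n : ℝ), (n : ℝ) + 1 / 2} : Set ℝ),
    ∀ σ : Matrix (Fin m) (Fin m) ℂ,
      traceNorm (NormedSpace.exp ((μ * τ) • S.A (ν * τ)) * σ *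
          NormedSpace.exp ((μ * τ) • (S.A (ν * τ))ᴴ) -
        e (μ * τ) (ν * τ) * σ * (e (μ * τ) (ν * τ))ᴴ) ≤ Ce * ε₂ * traceNorm σ

/-- One normalized step of the low-rank exponential midpoint scheme, from the factor `X` at time
`t` to the factor `X'` at time `t + τ`, with column compression tolerance `ε₁` and approximate
matrix exponentials `e`. The intermediate factors `G`, `Xh`, `Gh`, `Xhat` are those of the time
`t`, of the time `t + τ / 2` (two of them), and of the time `t + τ` before normalization. -/
def IsLREMStep (τ ε₁ : ℝ) (e : ℝ → ℝ → Matrix (Fin m) (Fin m) ℂ) (t : ℝ) {p p' : ℕ}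
    (X : Matrix (Fin m) (Fin p) ℂ) (X' : Matrix (Fin m) (Fin p') ℂ) : Prop :=
  ∃ (a b c : ℕ) (G : Matrix (Fin m) (Fin a) ℂ) (Xh : Matrix (Fin m) (Fin b) ℂ)
    (Gh : Matrix (Fin m) (Fin c) ℂ) (Xhat : Matrix (Fin m) (Fin p') ℂ),
    IsTruncatedSVD ε₁ (S.channelFactor τ t X) G ∧
    IsTruncatedSVD ε₁ (e (1 / 2 * τ) t * Matrix.fromCols X (√(1 / 2) • G)) Xh ∧
    IsTruncatedSVD ε₁ (S.channelFactor τ (t + τ / 2) Xh) Gh ∧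
    IsTruncatedSVD ε₁
      (Matrix.fromCols (e (1 * τ) (t + τ / 2) * X) (e (1 / 2 * τ) (t + τ / 2) * Gh)) Xhat ∧
    X' = (frobNorm Xhat)⁻¹ • Xhat

/-- The factors `X 0, …, X N` (with `w n` columns) are generated by the low-rank exponential
midpoint scheme with step size `τ` from an initial factor with `Tr (X₀ X₀ᴴ) = 1`. -/
def IsLREMRun (τ ε₁ : ℝ) (N : ℕ) (e : ℝ → ℝ → Matrix (Fin m) (Fin m) ℂ) (w : ℕ → ℕ)
    (X : (n : ℕ) → Matrix (Fin m) (Fin (w n)) ℂ) : Prop :=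
  (X 0 * (X 0)ᴴ).trace = 1 ∧ ∀ n < N, S.IsLREMStep τ ε₁ e (n * τ) (X n) (X (n + 1))

end System

end Lindblad

end

/-! The estimate is consistency plus stability, measured in the trace norm. Since `A + Aᴴ = -∑ γₖ
Lₖᴴ Lₖ ≤ 0`, the matrices `exp (s A)` with `s ≥ 0` are contractions, so the linear map `Φ` has norm
at most `1 + τ * growthRate` (`traceNorm_Φ_le`). A discrete Gronwall inequality
(`le_exp_mul_of_recurrence`) then turns local errors `τ * y` into a global error of order `y`.

Consistency: up to `O(τ³)`, both the flow and `Φ` agree with `1 + τ M + τ² M² / 2`, where `M` is the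
Lindblad generator at the midpoint (`exists_midpoint_consistency`). The symmetry about the midpoint
removes the time derivative of the generator.

Truncation: the residual `R = X - B` of a best rank-`r` approximation satisfies `R Bᴴ = 0`. Hence `X
Xᴴ = Y Yᴴ + R Rᴴ`, and the trace norm error is exactly `‖R‖_F² ≤ ε₁`. It is linear in `ε₁ = τ ϵ₁`,
so one power of `τ` is left for Gronwall.

Normalization: it changes `X̂ X̂ᴴ` by `|Tr (X̂ X̂ᴴ) - 1|`, or not at all if `X̂ = 0`. The range of
`M` is traceless, so the quadratic polynomial above preserves the trace and `Φ` does so up to `C₁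
τ³`. Normalizing therefore costs at most the local error once more, plus `C₁ τ³`.

Large tolerances: the local bound is not linear in `ϵ₂`, so it is used for `ϵ₂ ≤ 1` only. For `ϵ₂ >
1` both `ρ(tₙ)` and `ϱₙ` are bounded a priori, and `c₄ ϵ₂` absorbs this bound. -/

noncomputable section

namespace Lindblad

/-! ### Singular values and the trace norm by duality -/

section TraceNorm

open scoped Matrix.Norms.L2Operator

variable {ι κ : Type*} [Fintype ι] [DecidableEq ι] [Fintype κ] [DecidableEq κ]

theorem singVal_nonneg (X : Matrix ι κ ℂ) (j : ℕ) : 0 ≤ singVal X j :=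
  LinearMap.singularValues_nonneg _ _

/-- Unitary diagonalization of `Xᴴ X` by right singular vectors. -/
theorem exists_right_singular_vectors (X : Matrix ι κ ℂ) :
    ∃ V : Matrix κ (Fin (Fintype.card κ)) ℂ, Vᴴ * V = 1 ∧ V * Vᴴ = 1 ∧
      (X * V)ᴴ * (X * V) = Matrix.diagonal fun j : Fin (Fintype.card κ) => ((singVal X j : ℂ)) ^ 2 := by
  set T := Matrix.toEuclideanLin X with hTdef
  have hn : Module.finrank ℂ (EuclideanSpace ℂ κ) = Fintype.card κ := by simp
  have hT := T.isSymmetric_adjoint_comp_self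
  set b := hT.eigenvectorBasis hn with hb
  let V : Matrix κ (Fin (Fintype.card κ)) ℂ := Matrix.of fun i j => b j i
  have hV : Vᴴ * V = 1 := by
    ext i j
    have h := orthonormal_iff_ite.1 b.orthonormal i j
    rw [Matrix.one_apply, ← h, Matrix.mul_apply]
    simp [V, PiLp.inner_apply, mul_comm]
  have hV' : V * Vᴴ = 1 := (Matrix.mul_eq_one_comm_of_card_eq _ _ _ (by simp)).1 hV
  refine ⟨V, hV, hV', ?_⟩
  have hcol : Xᴴ * X * V = V * Matrix.diagonal fun j : Fin (Fintype.card κ) => ((singVal X j : ℂ)) ^ 2 := by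
    ext i j
    have h := hT.apply_eigenvectorBasis hn j
    rw [← hb, ← T.sq_singularValues_fin hn j, hTdef] at h
    rw [← Matrix.toEuclideanLin_conjTranspose_eq_adjoint] at h
    have h2 := congrArg (fun v : EuclideanSpace ℂ κ => v i) h
    simp only [LinearMap.comp_apply, Matrix.toLpLin_apply, Matrix.mulVec_mulVec] at h2
    rw [Matrix.mul_diagonal]
    simp only [PiLp.smul_apply, smul_eq_mul] at h2
    simp only [singVal, V, Matrix.of_apply]
    rw [mul_comm]
    push_cast at h2
    rw [← Complex.coe_algebraMap] 
    refine Eq.trans ?_ h2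
    rfl
  rw [Matrix.conjTranspose_mul, Matrix.mul_assoc, ← Matrix.mul_assoc Xᴴ, hcol, ← Matrix.mul_assoc,
    hV, Matrix.one_mul]

theorem norm_le_one_of_conjTranspose_mul_self_eq_one {X : Matrix ι κ ℂ} (h : Xᴴ * X = 1) :
    ‖X‖ ≤ 1 := by
  have h1 := Matrix.l2_opNorm_conjTranspose_mul_self X
  rw [h] at h1
  have h2 : ‖(1 : Matrix κ κ ℂ)‖ ≤ 1 := by
    rw [← Matrix.diagonal_one, Matrix.l2_opNorm_diagonal]
    exact (pi_norm_le_iff_of_nonneg zero_le_one).2 fun i => by simp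
  nlinarith [norm_nonneg X]

/-- Singular value decomposition with a partial isometry on the left. -/
theorem exists_svd (X : Matrix ι κ ℂ) :
    ∃ (W : Matrix ι (Fin (Fintype.card κ)) ℂ) (V : Matrix κ (Fin (Fintype.card κ)) ℂ),
      ‖W‖ ≤ 1 ∧ ‖V‖ ≤ 1 ∧
      X = W * (Matrix.diagonal fun j : Fin (Fintype.card κ) => (singVal X j : ℂ)) * Vᴴ ∧
      Wᴴ * X * V = Matrix.diagonal fun j : Fin (Fintype.card κ) => (singVal X j : ℂ) := by
  obtain ⟨V, hV, hV', hX⟩ := exists_right_singular_vectors X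
  set d : Fin (Fintype.card κ) → ℂ := fun j => (singVal X j : ℂ) with hd
  have hdiv : ∀ j, (d j)⁻¹ * (d j) ^ 2 = d j := fun j => by
    by_cases h : d j = 0
    · simp [h]
    · field_simp
  have hstar : ∀ j, star ((d j)⁻¹) = (d j)⁻¹ := fun j => by simp [hd]
  -- Normalizes the columns of `X * V`. As `0⁻¹ = 0`, the columns at vanishing singular values
  -- become zero, so `W` is in general only a partial isometry.
  set W := X * V * Matrix.diagonal (fun j => (d j)⁻¹) with hW
  have hWH : Wᴴ = Matrix.diagonal (fun j => (d j)⁻¹) * (X * V)ᴴ := by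
    rw [hW, Matrix.conjTranspose_mul, Matrix.diagonal_conjTranspose]
    congr 2
    funext j
    exact hstar j
  refine ⟨W, V, ?_, norm_le_one_of_conjTranspose_mul_self_eq_one hV, ?_, ?_⟩
  · have h1 := Matrix.l2_opNorm_conjTranspose_mul_self W
    have h2 : Wᴴ * W = Matrix.diagonal fun j => (d j)⁻¹ * d j := by
      rw [hWH, hW, Matrix.mul_assoc, ← Matrix.mul_assoc _ (X * V), hX, Matrix.diagonal_mul_diagonal,
        Matrix.diagonal_mul_diagonal]
      congr 1
      funext j
      rw [← mul_assoc, hdiv, mul_comm]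
    have h3 : ‖Matrix.diagonal fun j => (d j)⁻¹ * d j‖ ≤ 1 := by
      rw [Matrix.l2_opNorm_diagonal]
      refine (pi_norm_le_iff_of_nonneg zero_le_one).2 fun j => ?_
      by_cases h : d j = 0 <;> simp [h]
    rw [h2] at h1
    nlinarith [norm_nonneg W]
  -- A column of `X * V` has squared norm `(singVal X j)²`, so the columns that the diagonal factor
  -- deletes are already zero.
  · have h0 : X * V * Matrix.diagonal (fun j => (d j)⁻¹ * d j) = X * V := by
      ext i j
      rw [Matrix.mul_diagonal]
      by_cases h : d j = 0
      · have h1 := congrFun (congrFun hX j) j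
        rw [Matrix.diagonal_apply_eq, show ((singVal X j : ℂ)) = 0 from h, Matrix.mul_apply] at h1
        have h2 : ∑ k, ‖(X * V) k j‖ ^ 2 = 0 := by
          have h3 := congrArg Complex.re h1
          simp only [Matrix.conjTranspose_apply, Complex.re_sum] at h3
          rw [← (by simpa using h3 : _ = (0 : ℝ))]
          refine Finset.sum_congr rfl fun k _ => ?_
          rw [← Complex.normSq_eq_norm_sq, Complex.normSq_apply]
        have h3 := (Finset.sum_eq_zero_iff_of_nonneg fun k _ => by positivity).1 h2 i
          (Finset.mem_univ i)
        have h4 : (X * V) i j = 0 := by simpa using h3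
        simp [h4]
      · simp [h]
    rw [hW, Matrix.mul_assoc (X * V), Matrix.diagonal_mul_diagonal, h0, Matrix.mul_assoc, hV',
      Matrix.mul_one]
  · rw [Matrix.mul_assoc, hWH, Matrix.mul_assoc, hX, Matrix.diagonal_mul_diagonal]
    congr 1
    funext j
    exact hdiv j

theorem norm_entry_le_l2_opNorm (X : Matrix ι κ ℂ) (i : ι) (j : κ) : ‖X i j‖ ≤ ‖X‖ := by
  have h := Matrix.l2_opNorm_mulVec X (EuclideanSpace.single j 1)
  rw [PiLp.norm_single, norm_one, mul_one] at h
  refine le_trans ?_ h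
  refine le_trans (le_of_eq ?_) (PiLp.norm_apply_le _ i)
  simp

variable {m : ℕ}

theorem traceNorm_eq_sum_fin (A : Matrix (Fin m) (Fin m) ℂ) :
    traceNorm A = ∑ j : Fin (Fintype.card (Fin m)), singVal A j := by
  rw [traceNorm, Fin.sum_univ_eq_sum_range (fun j => singVal A j), Fintype.card_fin]

theorem traceNorm_nonneg (A : Matrix (Fin m) (Fin m) ℂ) : 0 ≤ traceNorm A :=
  Finset.sum_nonneg fun _ _ => singVal_nonneg _ _

/-- In the singular bases of `A` the trace sees only the diagonal entries of `Vᴴ * U * W`, weighted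
by the singular values, and each of them is at most `‖U‖`. -/
theorem norm_trace_mul_le (U A : Matrix (Fin m) (Fin m) ℂ) :
    ‖(U * A).trace‖ ≤ ‖U‖ * traceNorm A := by
  obtain ⟨W, V, hW, hV, hA, -⟩ := exists_svd A
  have hV' : ‖Vᴴ‖ ≤ 1 := by rwa [Matrix.l2_opNorm_conjTranspose]
  set D := Matrix.diagonal fun j : Fin (Fintype.card (Fin m)) => (singVal A j : ℂ)
  have h1 : (U * A).trace = (Vᴴ * U * W * D).trace := by
    conv_lhs => rw [hA, ← Matrix.mul_assoc, Matrix.trace_mul_comm]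
    simp only [Matrix.mul_assoc]
  have h2 : ‖Vᴴ * U * W‖ ≤ ‖U‖ :=
    calc ‖Vᴴ * U * W‖ ≤ ‖Vᴴ * U‖ * ‖W‖ := Matrix.l2_opNorm_mul _ _
      _ ≤ (‖Vᴴ‖ * ‖U‖) * ‖W‖ := by gcongr; exact Matrix.l2_opNorm_mul _ _
      _ ≤ (1 * ‖U‖) * 1 := by gcongr
      _ = ‖U‖ := by ring
  rw [h1, traceNorm_eq_sum_fin, Finset.mul_sum, Matrix.trace]
  refine (norm_sum_le _ _).trans (Finset.sum_le_sum fun j _ => ?_)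
  rw [Matrix.diag_apply, Matrix.mul_diagonal, norm_mul, Complex.norm_real, Real.norm_eq_abs,
    abs_of_nonneg (singVal_nonneg _ _)]
  gcongr
  · exact singVal_nonneg _ _
  · exact (norm_entry_le_l2_opNorm _ _ _).trans h2

/-- Equality in the duality bound. The trace norm is thus the maximum of `|Tr (U A)|` over
contractions `U`, which yields the triangle inequality and the ideal property without further use of
singular values. -/
theorem exists_trace_mul_eq_traceNorm (A : Matrix (Fin m) (Fin m) ℂ) :
    ∃ U : Matrix (Fin m) (Fin m) ℂ, ‖U‖ ≤ 1 ∧ (U * A).trace = traceNorm A := by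
  obtain ⟨W, V, hW, hV, -, hA⟩ := exists_svd A
  refine ⟨V * Wᴴ, ?_, ?_⟩
  · have hW' : ‖Wᴴ‖ ≤ 1 := by rwa [Matrix.l2_opNorm_conjTranspose]
    exact (Matrix.l2_opNorm_mul _ _).trans (mul_le_one₀ hV (norm_nonneg _) hW')
  · rw [Matrix.mul_assoc, Matrix.trace_mul_comm, hA, Matrix.trace_diagonal, traceNorm_eq_sum_fin]
    push_cast
    rfl

theorem traceNorm_le_of_forall {A : Matrix (Fin m) (Fin m) ℂ} {c : ℝ}
    (h : ∀ U : Matrix (Fin m) (Fin m) ℂ, ‖U‖ ≤ 1 → ‖(U * A).trace‖ ≤ c) : traceNorm A ≤ c := by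
  obtain ⟨U, hU, hA⟩ := exists_trace_mul_eq_traceNorm A
  have := h U hU
  rwa [hA, Complex.norm_real, Real.norm_eq_abs, abs_of_nonneg (traceNorm_nonneg A)] at this

theorem norm_trace_mul_le_of_norm_le_one {U : Matrix (Fin m) (Fin m) ℂ} (hU : ‖U‖ ≤ 1)
    (A : Matrix (Fin m) (Fin m) ℂ) : ‖(U * A).trace‖ ≤ traceNorm A :=
  (norm_trace_mul_le U A).trans (mul_le_of_le_one_left (traceNorm_nonneg A) hU)

theorem norm_one_matrix_le : ‖(1 : Matrix ι ι ℂ)‖ ≤ 1 :=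
  norm_le_one_of_conjTranspose_mul_self_eq_one (by simp)

theorem norm_trace_le (A : Matrix (Fin m) (Fin m) ℂ) : ‖A.trace‖ ≤ traceNorm A := by
  simpa using norm_trace_mul_le_of_norm_le_one norm_one_matrix_le A

theorem traceNorm_add_le (A B : Matrix (Fin m) (Fin m) ℂ) :
    traceNorm (A + B) ≤ traceNorm A + traceNorm B :=
  traceNorm_le_of_forall fun U hU => by
    rw [Matrix.mul_add, Matrix.trace_add]
    exact (norm_add_le _ _).trans (add_le_add (norm_trace_mul_le_of_norm_le_one hU A)
      (norm_trace_mul_le_of_norm_le_one hU B))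

@[simp]
theorem traceNorm_zero : traceNorm (0 : Matrix (Fin m) (Fin m) ℂ) = 0 :=
  le_antisymm (traceNorm_le_of_forall fun U _ => by simp) (traceNorm_nonneg _)

theorem traceNorm_sum_le {α : Type*} (s : Finset α) (f : α → Matrix (Fin m) (Fin m) ℂ) :
    traceNorm (∑ k ∈ s, f k) ≤ ∑ k ∈ s, traceNorm (f k) := by
  classical
  induction s using Finset.induction_on with
  | empty => simp
  | insert a s ha ih =>
    rw [Finset.sum_insert ha, Finset.sum_insert ha]
    exact (traceNorm_add_le _ _).trans (add_le_add le_rfl ih)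

theorem traceNorm_mul_mul_le (B A C : Matrix (Fin m) (Fin m) ℂ) :
    traceNorm (B * A * C) ≤ ‖B‖ * traceNorm A * ‖C‖ :=
  traceNorm_le_of_forall fun U hU => by
    have h1 : (U * (B * A * C)).trace = (C * U * B * A).trace := by
      rw [← Matrix.mul_assoc, Matrix.trace_mul_comm]
      simp only [Matrix.mul_assoc]
    rw [h1]
    refine (norm_trace_mul_le _ _).trans ?_
    calc ‖C * U * B‖ * traceNorm A ≤ (‖C‖ * ‖U‖ * ‖B‖) * traceNorm A := by
          gcongr
          · exact traceNorm_nonneg A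
          · refine (Matrix.l2_opNorm_mul _ _).trans ?_
            gcongr
            exact Matrix.l2_opNorm_mul _ _
      _ ≤ (‖C‖ * 1 * ‖B‖) * traceNorm A := by
          gcongr
          exact traceNorm_nonneg A
      _ = ‖B‖ * traceNorm A * ‖C‖ := by ring

theorem traceNorm_smul_le (c : ℝ) (A : Matrix (Fin m) (Fin m) ℂ) :
    traceNorm (c • A) ≤ |c| * traceNorm A :=
  traceNorm_le_of_forall fun U hU => by
    rw [Matrix.mul_smul, Matrix.trace_smul, norm_smul, Real.norm_eq_abs]
    gcongr
    exact norm_trace_mul_le_of_norm_le_one hU A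

theorem traceNorm_neg (A : Matrix (Fin m) (Fin m) ℂ) : traceNorm (-A) = traceNorm A := by
  have h : ∀ B : Matrix (Fin m) (Fin m) ℂ, traceNorm (-B) ≤ traceNorm B := fun B => by
    simpa using traceNorm_smul_le (-1) B
  exact le_antisymm (h A) (by simpa using h (-A))

theorem traceNorm_sub_comm (A B : Matrix (Fin m) (Fin m) ℂ) :
    traceNorm (A - B) = traceNorm (B - A) := by
  rw [← traceNorm_neg, neg_sub]

theorem traceNorm_sub_le (A B C : Matrix (Fin m) (Fin m) ℂ) :
    traceNorm (A - C) ≤ traceNorm (A - B) + traceNorm (B - C) := by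
  simpa using traceNorm_add_le (A - B) (B - C)

theorem traceNorm_le_add_sub (A B : Matrix (Fin m) (Fin m) ℂ) :
    traceNorm A ≤ traceNorm B + traceNorm (A - B) := by
  simpa using traceNorm_add_le B (A - B)

theorem norm_le_traceNorm (A : Matrix (Fin m) (Fin m) ℂ) : ‖A‖ ≤ traceNorm A := by
  obtain ⟨W, V, hW, hV, hA, -⟩ := exists_svd A
  have hV' : ‖Vᴴ‖ ≤ 1 := by rwa [Matrix.l2_opNorm_conjTranspose]
  set D := Matrix.diagonal fun j : Fin (Fintype.card (Fin m)) => (singVal A j : ℂ) with hD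
  have h1 : ‖D‖ ≤ traceNorm A := by
    rw [hD, Matrix.l2_opNorm_diagonal, traceNorm_eq_sum_fin]
    refine (pi_norm_le_iff_of_nonneg (Finset.sum_nonneg fun _ _ => singVal_nonneg _ _)).2
      fun j => ?_
    rw [Complex.norm_real, Real.norm_eq_abs, abs_of_nonneg (singVal_nonneg _ _)]
    exact Finset.single_le_sum (f := fun j : Fin (Fintype.card (Fin m)) => singVal A j)
      (fun _ _ => singVal_nonneg _ _) (Finset.mem_univ j)
  calc ‖A‖ = ‖W * D * Vᴴ‖ := by rw [← hA]
    _ ≤ ‖W‖ * ‖D‖ * ‖Vᴴ‖ := by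
        refine (Matrix.l2_opNorm_mul _ _).trans ?_
        gcongr
        exact Matrix.l2_opNorm_mul _ _
    _ ≤ 1 * traceNorm A * 1 := by
        gcongr
        exact mul_nonneg zero_le_one (traceNorm_nonneg A)
    _ = traceNorm A := by ring

theorem eq_zero_of_traceNorm_le_zero {A : Matrix (Fin m) (Fin m) ℂ} (h : traceNorm A ≤ 0) :
    A = 0 :=
  norm_le_zero_iff.1 ((norm_le_traceNorm A).trans h)

theorem traceNorm_le_mul_norm (A : Matrix (Fin m) (Fin m) ℂ) : traceNorm A ≤ m * ‖A‖ :=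
  traceNorm_le_of_forall fun U hU => by
    have h : ‖U * A‖ ≤ ‖A‖ :=
      (Matrix.l2_opNorm_mul _ _).trans (mul_le_of_le_one_left (norm_nonneg A) hU)
    refine (norm_sum_le _ _).trans ?_
    calc ∑ i, ‖(U * A).diag i‖ ≤ ∑ _i : Fin m, ‖A‖ :=
          Finset.sum_le_sum fun i _ => (norm_entry_le_l2_opNorm _ i i).trans h
      _ = m * ‖A‖ := by simp

/-- The real part of `Tr (X Xᴴ)`, as a sum of squares. -/
theorem re_trace_mul_conjTranspose_eq_sum {ι κ : Type*} [Fintype ι] [Fintype κ]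
    (X : Matrix ι κ ℂ) : (X * Xᴴ).trace = ((∑ i, ∑ k, ‖X i k‖ ^ 2 : ℝ) : ℂ) := by
  rw [Matrix.trace]
  push_cast
  refine Finset.sum_congr rfl fun i _ => ?_
  rw [Matrix.diag_apply, Matrix.mul_apply]
  refine Finset.sum_congr rfl fun k _ => ?_
  rw [Matrix.conjTranspose_apply, ← Complex.mul_conj']
  rfl

theorem trace_mul_conjTranspose_eq_frobNorm_sq {ι κ : Type*} [Fintype ι] [Fintype κ]
    (X : Matrix ι κ ℂ) : (X * Xᴴ).trace = ((frobNorm X ^ 2 : ℝ) : ℂ) := by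
  rw [re_trace_mul_conjTranspose_eq_sum, frobNorm, Matrix.frobenius_norm_def]
  congr 1
  rw [← Real.sqrt_eq_rpow, Real.sq_sqrt (by positivity)]
  norm_cast

theorem frobNorm_nonneg {ι κ : Type*} [Fintype ι] [Fintype κ] (X : Matrix ι κ ℂ) :
    0 ≤ frobNorm X :=
  letI := Matrix.frobeniusNormedAddCommGroup (m := ι) (n := κ) (α := ℂ)
  norm_nonneg X

/-- `Tr (U X Xᴴ)` is the sum of the quadratic forms of `U` at the columns of `X`, which gives the
upper bound; the trace itself (`U = 1`) gives the lower one. -/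
theorem traceNorm_mul_conjTranspose {κ : Type*} [Fintype κ] (X : Matrix (Fin m) κ ℂ) :
    traceNorm (X * Xᴴ) = frobNorm X ^ 2 := by
  classical
  refine le_antisymm (traceNorm_le_of_forall fun U hU => ?_) ?_
  · have h1 : (U * (X * Xᴴ)).trace = ∑ k, star (fun i => X i k) ⬝ᵥ U *ᵥ (fun i => X i k) := by
      rw [← Matrix.mul_assoc, Matrix.trace_mul_comm, Matrix.trace]
      refine Finset.sum_congr rfl fun k _ => ?_
      rw [Matrix.diag_apply, Matrix.mul_apply]
      rfl
    have h2 : ∀ k, ‖star (fun i => X i k) ⬝ᵥ U *ᵥ (fun i => X i k)‖ ≤ ∑ i, ‖X i k‖ ^ 2 := by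
      intro k
      set x : EuclideanSpace ℂ (Fin m) := WithLp.toLp 2 (fun i => X i k) with hx
      have h3 : star (fun i => X i k) ⬝ᵥ U *ᵥ (fun i => X i k)
          = inner ℂ x (Matrix.toEuclideanLin U x) := by
        rw [EuclideanSpace.inner_eq_star_dotProduct, dotProduct_comm]
        rfl
      have h4 : ‖x‖ ^ 2 = ∑ i, ‖X i k‖ ^ 2 := by
        rw [EuclideanSpace.norm_sq_eq]
      rw [h3, ← h4]
      refine (norm_inner_le_norm _ _).trans ?_
      have h5 : ‖Matrix.toEuclideanLin U x‖ ≤ ‖U‖ * ‖x‖ := Matrix.l2_opNorm_mulVec U x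
      nlinarith [norm_nonneg x, mul_le_of_le_one_left (norm_nonneg x) hU]
    have h5 : (frobNorm X ^ 2 : ℝ) = ∑ i, ∑ k, ‖X i k‖ ^ 2 := by
      have := (trace_mul_conjTranspose_eq_frobNorm_sq X).symm.trans
        (re_trace_mul_conjTranspose_eq_sum X)
      exact_mod_cast this
    rw [h1, h5, Finset.sum_comm]
    exact (norm_sum_le _ _).trans (Finset.sum_le_sum fun k _ => h2 k)
  · have h := norm_trace_le (X * Xᴴ)
    rwa [trace_mul_conjTranspose_eq_frobNorm_sq, Complex.norm_real, Real.norm_eq_abs,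
      abs_of_nonneg (by positivity)] at h

open scoped MatrixOrder in
theorem traceNorm_of_isDensity {ρ : Matrix (Fin m) (Fin m) ℂ} (h : IsDensity ρ) :
    traceNorm ρ = 1 := by
  obtain ⟨B, hB⟩ := CStarAlgebra.nonneg_iff_eq_mul_star_self.1 h.1.nonneg
  rw [Matrix.star_eq_conjTranspose] at hB
  have h2 := h.2
  rw [hB, trace_mul_conjTranspose_eq_frobNorm_sq] at h2
  rw [hB, traceNorm_mul_conjTranspose]
  exact_mod_cast h2

end TraceNorm

/-! ### Truncated singular value decompositions -/

section Truncation

variable {ι κ : Type*} [Fintype ι] [DecidableEq ι] [Fintype κ] [DecidableEq κ]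

/-- Cutting off the right singular vectors gives an approximation of rank at most `r` with the
error of the Eckart-Young theorem. -/
theorem exists_rank_le_frobNorm_sub_sq_eq (X : Matrix ι κ ℂ) (r : ℕ) :
    ∃ C : Matrix ι κ ℂ, C.rank ≤ r ∧
      frobNorm (X - C) ^ 2 = ∑ j ∈ Finset.Ico r (Fintype.card κ), singVal X j ^ 2 := by
  obtain ⟨V, hV, hV', hX⟩ := exists_right_singular_vectors X
  let p : Fin (Fintype.card κ) → ℂ := fun j => if (j : ℕ) < r then 1 else 0
  let q : Fin (Fintype.card κ) → ℂ := fun j => if (j : ℕ) < r then 0 else 1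
  refine ⟨X * V * Matrix.diagonal p * Vᴴ, ?_, ?_⟩
  · refine (Matrix.rank_mul_le_left _ _).trans ((Matrix.rank_mul_le_right _ _).trans ?_)
    rw [Matrix.rank_diagonal]
    have hinj : Function.Injective
        (fun j : {i // p i ≠ 0} => (⟨(j.1 : ℕ), by
          by_contra h
          exact j.2 (by simp [p, h])⟩ : Fin r)) := by
      intro a b hab
      simpa [Subtype.ext_iff, Fin.ext_iff] using hab
    simpa using Fintype.card_le_of_injective _ hinj
  · have h1 : X - X * V * Matrix.diagonal p * Vᴴ = X * V * Matrix.diagonal q * Vᴴ := by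
      have : Matrix.diagonal q = 1 - Matrix.diagonal p := by
        rw [← Matrix.diagonal_one, Matrix.diagonal_sub]
        congr 1
        funext j
        simp only [p, q]
        split_ifs <;> simp
      rw [this, Matrix.mul_sub, Matrix.sub_mul, Matrix.mul_one, Matrix.mul_assoc X V Vᴴ, hV',
        Matrix.mul_one]
    have hq : (Matrix.diagonal q)ᴴ = Matrix.diagonal q := by
      rw [Matrix.diagonal_conjTranspose]
      congr 1
      funext j
      simp only [q, Pi.star_apply]
      split_ifs <;> simp
    have h2 : ((X * V * Matrix.diagonal q * Vᴴ) * (X * V * Matrix.diagonal q * Vᴴ)ᴴ).trace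
        = ((∑ j ∈ Finset.Ico r (Fintype.card κ), singVal X j ^ 2 : ℝ) : ℂ) := by
      calc ((X * V * Matrix.diagonal q * Vᴴ) * (X * V * Matrix.diagonal q * Vᴴ)ᴴ).trace
          = (X * V * Matrix.diagonal q * (Vᴴ * V) * Matrix.diagonal q * (X * V)ᴴ).trace := by
            rw [Matrix.conjTranspose_mul, Matrix.conjTranspose_mul, hq,
              Matrix.conjTranspose_conjTranspose]
            simp only [Matrix.mul_assoc]
        _ = ((X * V)ᴴ * (X * V) * (Matrix.diagonal q * Matrix.diagonal q)).trace := by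
            rw [hV, Matrix.mul_one, Matrix.trace_mul_comm]
            simp only [Matrix.mul_assoc]
        _ = ∑ j : Fin (Fintype.card κ), if r ≤ (j : ℕ) then ((singVal X j : ℂ)) ^ 2 else 0 := by
            rw [hX, Matrix.diagonal_mul_diagonal, Matrix.diagonal_mul_diagonal,
              Matrix.trace_diagonal]
            refine Finset.sum_congr rfl fun j _ => ?_
            simp only [q]
            by_cases h : (j : ℕ) < r
            · simp [h]
            · simp [h, not_lt.1 h]
        _ = _ := by
            rw [Fin.sum_univ_eq_sum_range (fun j => if r ≤ j then ((singVal X j : ℂ)) ^ 2 else 0),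
              ← Finset.sum_filter]
            push_cast
            refine Finset.sum_congr ?_ fun _ _ => rfl
            ext j
            simp [and_comm]
    rw [← h1, trace_mul_conjTranspose_eq_frobNorm_sq] at h2
    exact_mod_cast h2

/-- The residual of a best approximation of given rank is orthogonal to the approximation. -/
theorem IsBestRankApprox.sub_mul_conjTranspose_eq_zero {r : ℕ} {X B : Matrix ι κ ℂ}
    (h : IsBestRankApprox r X B) : (X - B) * Bᴴ = 0 := by
  set R := X - B with hR
  set Z := R * Bᴴ with hZ
  -- First variation: `(1 + s • Z) * B` is an admissible competitor for every real `s`. Since `Z = R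
  -- * Bᴴ`, the term linear in `s` is exactly `-2 s ‖Z‖²`.
  have key : ∀ s : ℝ, 0 ≤ -2 * s * frobNorm Z ^ 2 + s ^ 2 * frobNorm (Z * B) ^ 2 := by
    intro s
    have h1 : ((1 + s • Z) * B).rank ≤ r := (Matrix.rank_mul_le_right _ _).trans h.1
    have h2 := h.2 _ h1
    have h3 : X - (1 + s • Z) * B = R - s • (Z * B) := by
      rw [hR, Matrix.add_mul, Matrix.one_mul, Matrix.smul_mul]
      abel
    rw [h3] at h2
    have h4 : frobNorm R ^ 2 ≤ frobNorm (R - s • (Z * B)) ^ 2 :=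
      pow_le_pow_left₀ (frobNorm_nonneg _) h2 2
    have e1 : (R * (Z * B)ᴴ).trace = ((frobNorm Z ^ 2 : ℝ) : ℂ) := by
      rw [Matrix.conjTranspose_mul, ← Matrix.mul_assoc, ← hZ, trace_mul_conjTranspose_eq_frobNorm_sq]
    have e2 : ((Z * B) * Rᴴ).trace = ((frobNorm Z ^ 2 : ℝ) : ℂ) := by
      have : (Z * B) * Rᴴ = (R * (Z * B)ᴴ)ᴴ := by
        rw [Matrix.conjTranspose_mul, Matrix.conjTranspose_conjTranspose]
      rw [this, Matrix.trace_conjTranspose, e1]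
      simp
    have e3 := trace_mul_conjTranspose_eq_frobNorm_sq (R - s • (Z * B))
    have e4 : (R - s • (Z * B)) * (R - s • (Z * B))ᴴ
        = R * Rᴴ - s • (R * (Z * B)ᴴ) - s • ((Z * B) * Rᴴ) + (s * s) • ((Z * B) * (Z * B)ᴴ) := by
      rw [Matrix.conjTranspose_sub, Matrix.conjTranspose_smul, star_trivial]
      simp only [Matrix.mul_sub, Matrix.sub_mul, Matrix.smul_mul, Matrix.mul_smul, smul_sub, smul_smul]
      abel
    rw [e4, Matrix.trace_add, Matrix.trace_sub, Matrix.trace_sub, Matrix.trace_smul,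
      Matrix.trace_smul, Matrix.trace_smul, e1, e2, trace_mul_conjTranspose_eq_frobNorm_sq,
      trace_mul_conjTranspose_eq_frobNorm_sq] at e3
    simp only [Complex.real_smul] at e3
    have e5 : frobNorm R ^ 2 - s * frobNorm Z ^ 2 - s * frobNorm Z ^ 2
        + s * s * frobNorm (Z * B) ^ 2 = frobNorm (R - s • (Z * B)) ^ 2 := by exact_mod_cast e3
    linarith
  have h0 : frobNorm Z ^ 2 = 0 := by
    set a := frobNorm Z ^ 2
    set b := frobNorm (Z * B) ^ 2 with hb
    have ha : 0 ≤ a := by positivity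
    have hb0 : 0 ≤ b := by positivity
    by_contra hne
    have hpos : 0 < a := lt_of_le_of_ne ha (Ne.symm hne)
    -- Nearly the minimizer `a / b` of the quadratic, shifted so that `b = 0` needs no separate
    -- case.
    have h4 := key (a / (b + 1))
    have h5 : -2 * (a / (b + 1)) * a + (a / (b + 1)) ^ 2 * b
        = a ^ 2 * (-(b + 2)) / (b + 1) ^ 2 := by
      field_simp
      ring
    rw [h5] at h4
    have h6 : a ^ 2 * (-(b + 2)) / (b + 1) ^ 2 < 0 := by
      apply div_neg_of_neg_of_pos _ (by positivity)
      have : 0 < a ^ 2 := by positivity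
      nlinarith
    linarith
  have h1 := re_trace_mul_conjTranspose_eq_sum Z
  rw [trace_mul_conjTranspose_eq_frobNorm_sq, h0] at h1
  have h2 : ∑ i, ∑ k, ‖Z i k‖ ^ 2 = 0 := by exact_mod_cast h1.symm
  ext i k
  have h3 := (Finset.sum_eq_zero_iff_of_nonneg fun i _ => by positivity).1 h2 i (Finset.mem_univ i)
  have h4 := (Finset.sum_eq_zero_iff_of_nonneg fun i _ => by positivity).1 h3 k (Finset.mem_univ k)
  simpa using h4

/-- Orthogonality of the residual kills the cross terms in `X * Xᴴ`. The size of the residual needs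
only one competitor with the Eckart-Young error, not the optimality of that error. -/
theorem IsTruncatedSVD.exists_residual {κ' : Type*} [Fintype κ'] {ε : ℝ} {X : Matrix ι κ ℂ}
    {Y : Matrix ι κ' ℂ} (h : IsTruncatedSVD ε X Y) :
    ∃ R : Matrix ι κ ℂ, X * Xᴴ = Y * Yᴴ + R * Rᴴ ∧ frobNorm R ^ 2 ≤ ε := by
  obtain ⟨r, B, hr, hB, hY⟩ := h
  refine ⟨X - B, ?_, ?_⟩
  · have h0 := hB.sub_mul_conjTranspose_eq_zero
    have h1 : B * (X - B)ᴴ = 0 := by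
      have := congrArg Matrix.conjTranspose h0
      simpa using this
    have h2 : X * Xᴴ = ((X - B) + B) * ((X - B) + B)ᴴ := by simp
    rw [h2, Matrix.conjTranspose_add, Matrix.mul_add, Matrix.add_mul, Matrix.add_mul, h0, h1, hY]
    abel
  · obtain ⟨C, hC, hCX⟩ := exists_rank_le_frobNorm_sub_sq_eq X r
    calc frobNorm (X - B) ^ 2 ≤ frobNorm (X - C) ^ 2 :=
          pow_le_pow_left₀ (frobNorm_nonneg _) (hB.2 C hC) 2
      _ ≤ ε := by rw [hCX]; exact hr.1

variable {m : ℕ}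

theorem IsTruncatedSVD.traceNorm_sub_le {κ' : Type*} [Fintype κ'] {ε : ℝ}
    {X : Matrix (Fin m) κ ℂ} {Y : Matrix (Fin m) κ' ℂ} (h : IsTruncatedSVD ε X Y) :
    traceNorm (X * Xᴴ - Y * Yᴴ) ≤ ε := by
  obtain ⟨R, hR, hε⟩ := h.exists_residual
  rw [hR, add_sub_cancel_left, traceNorm_mul_conjTranspose]
  exact hε

/-- The discarded part is positive semidefinite, so truncation never increases the norm. Hence the
size bounds of the scheme are free of `ε₁`, and no products `ε₁ ε₂` arise. -/
theorem IsTruncatedSVD.traceNorm_le {κ' : Type*} [Fintype κ'] {ε : ℝ}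
    {X : Matrix (Fin m) κ ℂ} {Y : Matrix (Fin m) κ' ℂ} (h : IsTruncatedSVD ε X Y) :
    traceNorm (Y * Yᴴ) ≤ traceNorm (X * Xᴴ) := by
  obtain ⟨R, hR, -⟩ := h.exists_residual
  have h1 := congrArg Matrix.trace hR
  simp only [Matrix.trace_add, trace_mul_conjTranspose_eq_frobNorm_sq] at h1
  have h2 : frobNorm X ^ 2 = frobNorm Y ^ 2 + frobNorm R ^ 2 := by exact_mod_cast h1
  rw [traceNorm_mul_conjTranspose, traceNorm_mul_conjTranspose, h2]
  linarith [sq_nonneg (frobNorm R)]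

end Truncation

/-! ### Taylor expansion and consistency of the midpoint rule -/

section Calculus

open Set

variable {E : Type*} [NormedAddCommGroup E] [NormedSpace ℝ E]

theorem norm_sub_le_of_norm_derivWithin_uIcc_le {f f' : ℝ → E} {C c x : ℝ}
    (hf : ∀ u ∈ uIcc c x, HasDerivWithinAt f (f' u) (uIcc c x) u)
    (bound : ∀ u ∈ uIcc c x, ‖f' u‖ ≤ C) : ‖f x - f c‖ ≤ C * |x - c| :=
  Convex.norm_image_sub_le_of_norm_hasDerivWithin_le hf bound (convex_uIcc c x)
    left_mem_uIcc right_mem_uIcc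

theorem abs_sub_le_of_mem_uIcc {c x u : ℝ} (hu : u ∈ uIcc c x) : |u - c| ≤ |x - c| :=
  abs_sub_left_of_mem_uIcc hu

/-- `K` bounds `g`, its Lipschitz constant, its derivative `g'`, and its second order Taylor
remainders on `s`. -/
structure TaylorBound (s : Set ℝ) (K : ℝ) (g g' : ℝ → E) : Prop where
  norm_le : ∀ u ∈ s, ‖g u‖ ≤ K
  norm_deriv_le : ∀ u ∈ s, ‖g' u‖ ≤ K
  lipschitz : ∀ u ∈ s, ∀ v ∈ s, ‖g v - g u‖ ≤ K * |v - u|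
  taylor : ∀ u ∈ s, ∀ v ∈ s, ‖g v - g u - (v - u) • g' u‖ ≤ K * |v - u| ^ 2

theorem TaylorBound.mono {s : Set ℝ} {K K' : ℝ} {g g' : ℝ → E} (h : TaylorBound s K g g')
    (hK : K ≤ K') : TaylorBound s K' g g' where
  norm_le u hu := (h.norm_le u hu).trans hK
  norm_deriv_le u hu := (h.norm_deriv_le u hu).trans hK
  lipschitz u hu v hv := (h.lipschitz u hu v hv).trans (by gcongr)
  taylor u hu v hv := (h.taylor u hu v hv).trans (by gcongr)

theorem exists_taylorBound_of_contDiffOn {T : ℝ} (hT : 0 < T) {g : ℝ → E}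
    (hg : ContDiffOn ℝ 2 g (Icc 0 T)) :
    ∃ (K : ℝ) (g' : ℝ → E), 0 ≤ K ∧ TaylorBound (Icc 0 T) K g g' := by
  have hu : UniqueDiffOn ℝ (Icc 0 T) := uniqueDiffOn_Icc hT
  set g' := derivWithin g (Icc 0 T) with hg'
  set g'' := derivWithin g' (Icc 0 T) with hg''
  have h1 : ContDiffOn ℝ 1 g' (Icc 0 T) := hg.derivWithin hu (by norm_num)
  have h2 : ContDiffOn ℝ 0 g'' (Icc 0 T) := h1.derivWithin hu (by norm_num)
  have d1 : ∀ u ∈ Icc 0 T, HasDerivWithinAt g (g' u) (Icc 0 T) u := fun u hu' =>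
    ((hg.differentiableOn (by norm_num)) u hu').hasDerivWithinAt
  have d2 : ∀ u ∈ Icc 0 T, HasDerivWithinAt g' (g'' u) (Icc 0 T) u := fun u hu' =>
    ((h1.differentiableOn (by norm_num)) u hu').hasDerivWithinAt
  obtain ⟨K0, hK0⟩ := isCompact_Icc.exists_bound_of_continuousOn hg.continuousOn
  obtain ⟨K1, hK1⟩ := isCompact_Icc.exists_bound_of_continuousOn h1.continuousOn
  obtain ⟨K2, hK2⟩ := isCompact_Icc.exists_bound_of_continuousOn h2.continuousOn
  set K := max (max K0 K1) K2 with hK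
  have k0 : K0 ≤ K := (le_max_left _ _).trans (le_max_left _ _)
  have k1 : K1 ≤ K := (le_max_right _ _).trans (le_max_left _ _)
  have k2 : K2 ≤ K := le_max_right _ _
  have hK_nonneg : 0 ≤ K := ((norm_nonneg _).trans (hK0 0 ⟨le_rfl, hT.le⟩)).trans k0
  refine ⟨K, g', hK_nonneg, fun u hu => (hK0 u hu).trans k0, fun u hu => (hK1 u hu).trans k1,
    fun u hu v hv => ?_, fun u hu v hv => ?_⟩
  · have hsub : uIcc u v ⊆ Icc 0 T := uIcc_subset_Icc hu hv
    exact norm_sub_le_of_norm_derivWithin_uIcc_le (fun w hw => (d1 w (hsub hw)).mono hsub)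
      fun w hw => (hK1 w (hsub hw)).trans k1
  · have hsub : uIcc u v ⊆ Icc 0 T := uIcc_subset_Icc hu hv
    have h3 : ∀ w ∈ uIcc u v, ‖g' w - g' u‖ ≤ K * |v - u| := fun w hw => by
      have hsub' : uIcc u w ⊆ Icc 0 T := uIcc_subset_Icc hu (hsub hw)
      refine (norm_sub_le_of_norm_derivWithin_uIcc_le (fun z hz => (d2 z (hsub' hz)).mono hsub')
        fun z hz => (hK2 z (hsub' hz)).trans k2).trans ?_
      exact mul_le_mul_of_nonneg_left (abs_sub_le_of_mem_uIcc hw) hK_nonneg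
    have h4 := norm_sub_le_of_norm_derivWithin_uIcc_le
      (f := fun w => g w - (w - u) • g' u) (f' := fun w => g' w - g' u) (c := u) (x := v)
      (fun w hw => by
        have := ((d1 w (hsub hw)).mono hsub).sub
          (((hasDerivWithinAt_id w (uIcc u v)).sub_const u).smul_const (g' u))
        exact this.congr_deriv (by simp)) h3
    calc ‖g v - g u - (v - u) • g' u‖ = ‖g v - (v - u) • g' u - (g u - (u - u) • g' u)‖ := by
          congr 1
          simp only [sub_self, zero_smul, sub_zero]
          abel
      _ ≤ K * |v - u| * |v - u| := h4
      _ = K * |v - u| ^ 2 := by ring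

/-- Third order Taylor expansion, about an arbitrary point, of a solution of `ρ' = 𝓛(t) ρ`. -/
theorem norm_solution_taylor_le {s : Set ℝ} (hs : s.OrdConnected) {K R : ℝ} (hK : 0 ≤ K)
    (hR : 0 ≤ R) {𝓛 𝓛' : ℝ → E →L[ℝ] E} (h𝓛 : TaylorBound s K 𝓛 𝓛') {ρ : ℝ → E}
    (hρ : ∀ t ∈ s, HasDerivWithinAt ρ (𝓛 t (ρ t)) s t) (hρR : ∀ t ∈ s, ‖ρ t‖ ≤ R)
    {c x : ℝ} (hc : c ∈ s) (hx : x ∈ s) :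
    ‖ρ x - ρ c‖ ≤ K * R * |x - c| ∧
    ‖ρ x - ρ c - (x - c) • 𝓛 c (ρ c)‖ ≤ (K + K ^ 2) * R * |x - c| ^ 2 ∧
    ‖ρ x - ρ c - (x - c) • 𝓛 c (ρ c) - ((x - c) ^ 2 / 2) • (𝓛' c (ρ c) + 𝓛 c (𝓛 c (ρ c)))‖
      ≤ (K + 2 * K ^ 2 + K ^ 3) * R * |x - c| ^ 3 := by
  have hop : ∀ (A : E →L[ℝ] E) (v : E) (a b : ℝ), ‖A‖ ≤ a → ‖v‖ ≤ b → ‖A v‖ ≤ a * b :=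
    fun A v a b ha hb => A.le_of_opNorm_le_of_le ha hb
  have step1 : ∀ y ∈ s, ‖ρ y - ρ c‖ ≤ K * R * |y - c| := fun y hy => by
    have hsub : uIcc c y ⊆ s := hs.uIcc_subset hc hy
    exact norm_sub_le_of_norm_derivWithin_uIcc_le (fun u hu => (hρ u (hsub hu)).mono hsub)
      fun u hu => hop _ _ _ _ (h𝓛.norm_le u (hsub hu)) (hρR u (hsub hu))
  have step2 : ∀ y ∈ s, ‖ρ y - ρ c - (y - c) • 𝓛 c (ρ c)‖ ≤ (K + K ^ 2) * R * |y - c| ^ 2 :=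
    fun y hy => by
    have hsub : uIcc c y ⊆ s := hs.uIcc_subset hc hy
    have h := norm_sub_le_of_norm_derivWithin_uIcc_le
      (f := fun w => ρ w - (w - c) • 𝓛 c (ρ c)) (f' := fun w => 𝓛 w (ρ w) - 𝓛 c (ρ c))
      (c := c) (x := y) (C := (K + K ^ 2) * R * |y - c|)
      (fun w hw => by
        have := ((hρ w (hsub hw)).mono hsub).sub
          (((hasDerivWithinAt_id w (uIcc c y)).sub_const c).smul_const (𝓛 c (ρ c)))
        exact this.congr_deriv (by simp))
      (fun w hw => by
        have e : 𝓛 w (ρ w) - 𝓛 c (ρ c) = (𝓛 w - 𝓛 c) (ρ w) + 𝓛 c (ρ w - ρ c) := by simp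
        have hw' := abs_sub_le_of_mem_uIcc hw
        rw [e]
        calc _ ≤ ‖(𝓛 w - 𝓛 c) (ρ w)‖ + ‖𝓛 c (ρ w - ρ c)‖ := norm_add_le _ _
          _ ≤ K * |w - c| * R + K * (K * R * |w - c|) :=
              add_le_add (hop _ _ _ _ (h𝓛.lipschitz c hc w (hsub hw)) (hρR w (hsub hw)))
                (hop _ _ _ _ (h𝓛.norm_le c hc) (step1 w (hsub hw)))
          _ = (K + K ^ 2) * R * |w - c| := by ring
          _ ≤ _ := by gcongr)
    calc _ = ‖ρ y - (y - c) • 𝓛 c (ρ c) - (ρ c - (c - c) • 𝓛 c (ρ c))‖ := by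
          congr 1
          simp only [sub_self, zero_smul, sub_zero]
          abel
      _ ≤ _ := h
      _ = _ := by ring
  refine ⟨step1 x hx, step2 x hx, ?_⟩
  have hsub : uIcc c x ⊆ s := hs.uIcc_subset hc hx
  -- This plays the role of `ρ''(c)`. No third derivative of `ρ` is used: the mean value inequality
  -- is applied to the remainder, whose derivative is split below into the Taylor remainder of `𝓛`
  -- and the two lower order remainders of `ρ`.
  set V := 𝓛' c (ρ c) + 𝓛 c (𝓛 c (ρ c)) with hV
  have h := norm_sub_le_of_norm_derivWithin_uIcc_le
    (f := fun w => ρ w - (w - c) • 𝓛 c (ρ c) - ((w - c) ^ 2 / 2) • V)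
    (f' := fun w => 𝓛 w (ρ w) - 𝓛 c (ρ c) - (w - c) • V)
    (c := c) (x := x) (C := (K + 2 * K ^ 2 + K ^ 3) * R * |x - c| ^ 2)
    (fun w hw => by
      have h1 := ((hρ w (hsub hw)).mono hsub).sub
        (((hasDerivWithinAt_id w (uIcc c x)).sub_const c).smul_const (𝓛 c (ρ c)))
      have h2 : HasDerivWithinAt (fun w : ℝ => (w - c) ^ 2 / 2) (w - c) (uIcc c x) w := by
        have := (((hasDerivWithinAt_id w (uIcc c x)).sub_const c).pow 2).div_const 2
        refine this.congr_deriv ?_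
        simp
      have h3 := h1.sub (h2.smul_const V)
      exact h3.congr_deriv (by simp))
    (fun w hw => by
      have e : 𝓛 w (ρ w) - 𝓛 c (ρ c) - (w - c) • V = (𝓛 w - 𝓛 c - (w - c) • 𝓛' c) (ρ w) +
          (w - c) • 𝓛' c (ρ w - ρ c) + 𝓛 c (ρ w - ρ c - (w - c) • 𝓛 c (ρ c)) := by
        simp only [hV, sub_apply, smul_apply, map_sub,
          map_smul, smul_add, smul_sub]
        abel
      have hw' := abs_sub_le_of_mem_uIcc hw
      rw [e]
      calc _ ≤ ‖(𝓛 w - 𝓛 c - (w - c) • 𝓛' c) (ρ w)‖ + ‖(w - c) • 𝓛' c (ρ w - ρ c)‖ +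
            ‖𝓛 c (ρ w - ρ c - (w - c) • 𝓛 c (ρ c))‖ := norm_add₃_le
        _ ≤ K * |w - c| ^ 2 * R + |w - c| * (K * (K * R * |w - c|)) +
            K * ((K + K ^ 2) * R * |w - c| ^ 2) := by
            refine add_le_add (add_le_add ?_ ?_) ?_
            · exact hop _ _ _ _ (h𝓛.taylor c hc w (hsub hw)) (hρR w (hsub hw))
            · rw [norm_smul, Real.norm_eq_abs]
              gcongr
              exact hop _ _ _ _ (h𝓛.norm_deriv_le c hc) (step1 w (hsub hw))
            · exact hop _ _ _ _ (h𝓛.norm_le c hc) (step2 w (hsub hw))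
        _ = (K + 2 * K ^ 2 + K ^ 3) * R * |w - c| ^ 2 := by ring
        _ ≤ _ := by gcongr)
  calc _ = ‖ρ x - (x - c) • 𝓛 c (ρ c) - ((x - c) ^ 2 / 2) • V -
        (ρ c - (c - c) • 𝓛 c (ρ c) - ((c - c) ^ 2 / 2) • V)‖ := by
        congr 1
        simp only [sub_self, zero_smul, sub_zero, ne_eq, OfNat.ofNat_ne_zero, not_false_eq_true,
          zero_pow, zero_div]
        abel
    _ ≤ _ := h
    _ = _ := by ring

/-- A solution of `ρ' = 𝓛(t) ρ` over a step of size `2h` agrees up to third order with the second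
order Taylor polynomial of the exponential of the generator at the midpoint. -/
theorem norm_solution_sub_midpoint_expansion_le {s : Set ℝ} (hs : s.OrdConnected) {K R : ℝ}
    (hK : 0 ≤ K) (hR : 0 ≤ R) {𝓛 𝓛' : ℝ → E →L[ℝ] E} (h𝓛 : TaylorBound s K 𝓛 𝓛') {ρ : ℝ → E}
    (hρ : ∀ t ∈ s, HasDerivWithinAt ρ (𝓛 t (ρ t)) s t) (hρR : ∀ t ∈ s, ‖ρ t‖ ≤ R)
    {t h : ℝ} (h0 : 0 ≤ h) (ht : t ∈ s) (hth : t + 2 * h ∈ s) :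
    ‖ρ (t + 2 * h) - (1 + 2 * (h • 𝓛 (t + h)) + 2 * (h • 𝓛 (t + h)) ^ 2 : E →L[ℝ] E) (ρ t)‖
      ≤ (2 * K + 6 * K ^ 2 + 6 * K ^ 3) * R * h ^ 3 := by
  set c := t + h with hc
  have hcs : c ∈ s := hs.out ht hth ⟨by linarith, by linarith⟩
  obtain ⟨a1, a2, a3⟩ := norm_solution_taylor_le hs hK hR h𝓛 hρ hρR hcs ht
  obtain ⟨-, -, b3⟩ := norm_solution_taylor_le hs hK hR h𝓛 hρ hρR hcs hth
  have e1 : t - c = -h := by rw [hc]; ring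
  have e2 : t + 2 * h - c = h := by rw [hc]; ring
  rw [e1, abs_neg, abs_of_nonneg h0] at a1 a2 a3
  rw [e2, abs_of_nonneg h0] at b3
  rw [neg_sq] at a3
  set V := 𝓛' c (ρ c) + 𝓛 c (𝓛 c (ρ c))
  set M := 𝓛 c with hM
  have hop : ∀ v : E, ‖M v‖ ≤ K * ‖v‖ := fun v =>
    M.le_of_opNorm_le (h𝓛.norm_le c hcs) v
  set W1 := ρ (t + 2 * h) - ρ c - h • M (ρ c) - (h ^ 2 / 2) • V with hW1
  set W2 := ρ t - ρ c - (-h) • M (ρ c) - (h ^ 2 / 2) • V with hW2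
  set W3 := ρ t - ρ c - (-h) • M (ρ c) with hW3
  -- Both end points lie at distance `h` from `c`, so `V`, and with it `𝓛' c`, cancels in `W1 - W2`.
  -- The last term accounts for replacing `ρ c` by its expansion about `ρ t`.
  have key : ρ (t + 2 * h) - (1 + 2 * (h • M) + 2 * (h • M) ^ 2 : E →L[ℝ] E) (ρ t)
      = W1 - W2 - (2 * h) • M (W3 + h • M (ρ t - ρ c)) := by
    have e3 : (1 + 2 * (h • M) + 2 * (h • M) ^ 2 : E →L[ℝ] E) (ρ t)
        = ρ t + (2 * h) • M (ρ t) + (2 * h ^ 2) • M (M (ρ t)) := by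
      simp only [two_mul, pow_two, add_apply, mul_apply_eq_comp,
        one_apply_eq_self, smul_apply, map_smul, add_smul,
        smul_smul]
    rw [e3, hW1, hW2, hW3]
    simp only [map_sub, map_smul, map_add]
    module
  rw [key]
  calc _ ≤ ‖W1‖ + ‖W2‖ + ‖(2 * h) • M (W3 + h • M (ρ t - ρ c))‖ :=
        (norm_sub_le _ _).trans (add_le_add (norm_sub_le _ _) le_rfl)
    _ ≤ (K + 2 * K ^ 2 + K ^ 3) * R * h ^ 3 + (K + 2 * K ^ 2 + K ^ 3) * R * h ^ 3 +
        2 * h * (K * ((K + K ^ 2) * R * h ^ 2 + h * (K * (K * R * h)))) := by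
        refine add_le_add (add_le_add b3 a3) ?_
        rw [norm_smul, Real.norm_eq_abs, abs_of_nonneg (by positivity)]
        gcongr
        refine (hop _).trans ?_
        gcongr
        refine (norm_add_le _ _).trans (add_le_add a2 ?_)
        rw [norm_smul, Real.norm_eq_abs, abs_of_nonneg h0]
        gcongr
        exact (hop _).trans (by gcongr)
    _ = _ := by ring

theorem norm_solution_le {T K : ℝ} {𝓛 : ℝ → E →L[ℝ] E}
    (h𝓛 : ∀ t ∈ Icc 0 T, ‖𝓛 t‖ ≤ K) {ρ : ℝ → E}
    (hρ : ∀ t ∈ Icc 0 T, HasDerivWithinAt ρ (𝓛 t (ρ t)) (Icc 0 T) t) (hK : 0 ≤ K) :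
    ∀ t ∈ Icc 0 T, ‖ρ t‖ ≤ Real.exp (K * T) * ‖ρ 0‖ := by
  intro t ht
  have h := norm_le_gronwallBound_of_norm_deriv_right_le (f := ρ) (f' := fun t => 𝓛 t (ρ t))
    (δ := ‖ρ 0‖) (K := K) (ε := 0) (a := 0) (b := T)
    (fun t ht => (hρ t ht).continuousWithinAt)
    (fun x hx => by
      have h1 := (hρ x ⟨hx.1, hx.2.le⟩).mono (Icc_subset_Icc_left hx.1)
      rw [hasDerivWithinAt_iff_hasFDerivWithinAt] at h1 ⊢
      exact h1.mono_of_mem_nhdsWithin (Icc_mem_nhdsGE hx.2))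
    le_rfl (fun x hx => by
      rw [add_zero]
      exact (𝓛 x).le_of_opNorm_le (h𝓛 x ⟨hx.1, hx.2.le⟩) _) t ht
  rw [gronwallBound_ε0, sub_zero] at h
  refine h.trans ?_
  rw [mul_comm]
  gcongr
  exact ht.2

/-- Taylor expansions of a contractive one-parameter semigroup with bounded generator `D`. -/
theorem norm_semigroup_taylor_le {𝔸 : Type*} [NormedRing 𝔸] [NormedAlgebra ℝ 𝔸] {P : ℝ → 𝔸}
    {D : 𝔸} {k : ℝ} (hk : 0 ≤ k) (hD : ‖D‖ ≤ k) (hP0 : P 0 = 1)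
    (hP : ∀ s, HasDerivAt P (D * P s) s) (hP1 : ∀ s, 0 ≤ s → ‖P s‖ ≤ 1) {s : ℝ} (hs : 0 ≤ s) :
    ‖P s - 1 - s • D‖ ≤ k ^ 2 * s ^ 2 ∧
    ‖P s - 1 - s • D - (s ^ 2 / 2) • D ^ 2‖ ≤ k ^ 3 * s ^ 3 := by
  have hmul : ∀ (v : 𝔸) (b : ℝ), ‖v‖ ≤ b → ‖D * v‖ ≤ k * b := fun v b hv =>
    (norm_mul_le _ _).trans (mul_le_mul hD hv (norm_nonneg _) hk)
  have mem : ∀ {s : ℝ}, 0 ≤ s → ∀ u ∈ uIcc 0 s, 0 ≤ u ∧ u ≤ s := fun {s} hs u hu => by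
    rwa [uIcc_of_le hs] at hu
  -- Each order follows from the previous one through `P' = D * P`. Contractivity starts the
  -- bootstrap, so no factor `exp (k * s)` appears.
  have step1 : ∀ s, 0 ≤ s → ‖P s - 1‖ ≤ k * s := fun s hs => by
    have h := norm_sub_le_of_norm_derivWithin_uIcc_le (f := P) (f' := fun u => D * P u) (c := 0)
      (x := s) (C := k * 1) (fun u _ => (hP u).hasDerivWithinAt)
      (fun u hu => hmul _ _ (hP1 u (mem hs u hu).1))
    rwa [hP0, sub_zero, abs_of_nonneg hs, mul_one] at h
  have step2 : ∀ s, 0 ≤ s → ‖P s - 1 - s • D‖ ≤ k ^ 2 * s ^ 2 := fun s hs => by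
    have h := norm_sub_le_of_norm_derivWithin_uIcc_le (f := fun u => P u - u • D)
      (f' := fun u => D * (P u - 1)) (c := 0) (x := s) (C := k * (k * s))
      (fun u _ => by
        have := (hP u).sub ((hasDerivAt_id u).smul_const D)
        exact this.hasDerivWithinAt.congr_deriv (by simp [mul_sub]))
      (fun u hu => hmul _ _ ((step1 u (mem hs u hu).1).trans (by gcongr; exact (mem hs u hu).2)))
    rw [hP0, sub_zero, abs_of_nonneg hs, zero_smul, sub_zero, sub_right_comm] at h
    exact h.trans_eq (by ring)
  refine ⟨step2 s hs, ?_⟩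
  have h := norm_sub_le_of_norm_derivWithin_uIcc_le
    (f := fun u => P u - u • D - (u ^ 2 / 2) • D ^ 2)
    (f' := fun u => D * (P u - 1 - u • D)) (c := 0) (x := s) (C := k * (k ^ 2 * s ^ 2))
    (fun u _ => by
      have h2 : HasDerivAt (fun w : ℝ => w ^ 2 / 2) u u := by
        refine ((hasDerivAt_pow 2 u).div_const 2).congr_deriv ?_
        simp
      have h3 := ((hP u).sub ((hasDerivAt_id u).smul_const D)).sub (h2.smul_const (D ^ 2))
      refine h3.hasDerivWithinAt.congr_deriv ?_
      simp [mul_sub, pow_two])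
    (fun u hu => hmul _ _ ((step2 u (mem hs u hu).1).trans (by
      have := (mem hs u hu).1
      gcongr
      exact (mem hs u hu).2)))
  rw [hP0, sub_zero, abs_of_nonneg hs] at h
  calc _ = ‖P s - s • D - (s ^ 2 / 2) • D ^ 2 -
        (1 - (0 : ℝ) • D - ((0 : ℝ) ^ 2 / 2) • D ^ 2)‖ := by
        congr 1
        simp only [zero_smul, sub_zero, ne_eq, OfNat.ofNat_ne_zero, not_false_eq_true,
          zero_pow, zero_div]
        abel
    _ ≤ _ := h
    _ = _ := by ring

/-- The algebra behind the consistency of the exponential midpoint rule. -/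
theorem norm_midpoint_step_sub_expansion_le {𝔸 : Type*} [NormedRing 𝔸]
    (h1 : ‖(1 : 𝔸)‖ ≤ 1) {p₁ p₂ p₀ x y x' y' : 𝔸} {K C h H : ℝ} (hK : 0 ≤ K)
    (hh : 0 ≤ h) (hH : h ≤ H) (hx : ‖x‖ ≤ K * h) (hy : ‖y‖ ≤ K * h) (hx' : ‖x'‖ ≤ K * h)
    (hy' : ‖y'‖ ≤ K * h) (hp₀ : ‖p₀‖ ≤ 1)
    (hp₁ : ‖p₁ - 1 - 2 * x - 2 * x ^ 2‖ ≤ C * h ^ 3) (hp₂ : ‖p₂ - 1 - x‖ ≤ C * h ^ 2)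
    (hp₀' : ‖p₀ - 1 - x'‖ ≤ C * h ^ 2) (hxx : ‖x' - x‖ ≤ K * h ^ 2)
    (hyy : ‖y' - y‖ ≤ K * h ^ 2) :
    ‖p₁ + 2 * (p₂ * y * p₀ * (1 + y')) - (1 + 2 * (x + y) + 2 * (x + y) ^ 2)‖ ≤
      (C + 2 * (C * K * (1 + K * H)) + 2 * ((1 + K * H) * K * C * (1 + K * H)) +
        2 * (K * (K + K)) + 2 * (K * K * K) + 2 * (K * K * (K + K + K * K * H))) * h ^ 3 := by
  have hH0 : 0 ≤ H := hh.trans hH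
  have hmul : ∀ {u v : 𝔸} {a b : ℝ}, ‖u‖ ≤ a → ‖v‖ ≤ b → ‖u * v‖ ≤ a * b :=
    fun {u v a b} hu hv =>
      (norm_mul_le _ _).trans (mul_le_mul hu hv (norm_nonneg _) ((norm_nonneg _).trans hu))
  have htwo : ∀ {u : 𝔸} {a : ℝ}, ‖u‖ ≤ a → ‖2 * u‖ ≤ 2 * a := fun {u a} hu => by
    rw [two_mul, two_mul]
    exact (norm_add_le _ _).trans (add_le_add hu hu)
  have hKh : K * h ≤ K * H := by gcongr
  have hy1 : ‖1 + y'‖ ≤ 1 + K * H := (norm_add_le _ _).trans (add_le_add h1 (hy'.trans hKh))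
  have hx1 : ‖1 + x‖ ≤ 1 + K * H := (norm_add_le _ _).trans (add_le_add h1 (hx.trans hKh))
  -- Here `x`, `y` stand for `h D`, `h J` at the midpoint, `x'`, `y'` for their values at the left
  -- end, and the `pᵢ` for semigroup factors. Up to second order the scheme gives `2x + 2x² + 2y +
  -- 2xy + 2y(x + y)`, which is `2(x + y) + 2(x + y)²` without any commutation; each remaining term
  -- is `O(h³)`.
  have key : p₁ + 2 * (p₂ * y * p₀ * (1 + y')) - (1 + 2 * (x + y) + 2 * (x + y) ^ 2)
      = (p₁ - 1 - 2 * x - 2 * x ^ 2) + 2 * ((p₂ - 1 - x) * y * p₀ * (1 + y')) +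
        2 * ((1 + x) * y * (p₀ - 1 - x') * (1 + y')) + 2 * (y * ((x' - x) + (y' - y))) +
        2 * (y * x' * y') + 2 * (x * y * (x' + y' + x' * y')) := by
    noncomm_ring
  have b2 : ‖2 * ((p₂ - 1 - x) * y * p₀ * (1 + y'))‖
      ≤ 2 * (C * h ^ 2 * (K * h) * 1 * (1 + K * H)) :=
    htwo (hmul (hmul (hmul hp₂ hy) hp₀) hy1)
  have b3 : ‖2 * ((1 + x) * y * (p₀ - 1 - x') * (1 + y'))‖
      ≤ 2 * ((1 + K * H) * (K * h) * (C * h ^ 2) * (1 + K * H)) :=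
    htwo (hmul (hmul (hmul hx1 hy) hp₀') hy1)
  have b4 : ‖2 * (y * ((x' - x) + (y' - y)))‖ ≤ 2 * (K * h * (K * h ^ 2 + K * h ^ 2)) :=
    htwo (hmul hy ((norm_add_le _ _).trans (add_le_add hxx hyy)))
  have b5 : ‖2 * (y * x' * y')‖ ≤ 2 * (K * h * (K * h) * (K * h)) := htwo (hmul (hmul hy hx') hy')
  have b6 : ‖2 * (x * y * (x' + y' + x' * y'))‖
      ≤ 2 * (K * h * (K * h) * (K * h + K * h + K * h * (K * H))) :=
    htwo (hmul (hmul hx hy) (norm_add₃_le.trans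
      (add_le_add (add_le_add hx' hy') (hmul hx' (hy'.trans hKh)))))
  rw [key]
  refine ((norm_add_le _ _).trans (add_le_add ((norm_add_le _ _).trans (add_le_add
    ((norm_add_le _ _).trans (add_le_add ((norm_add_le _ _).trans (add_le_add
    ((norm_add_le _ _).trans (add_le_add hp₁ b2)) b3)) b4)) b5)) b6)).trans_eq ?_
  ring

/-- Consistency of the exponential midpoint rule for `ρ' = (D(t) + J(t)) ρ`, where `P s t` is the
contraction semigroup generated by `D(t)`. -/
theorem exists_midpoint_consistency {T : ℝ} (hT : 0 < T) {D J : ℝ → E →L[ℝ] E}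
    {P : ℝ → ℝ → E →L[ℝ] E} (hD : ContDiffOn ℝ 2 D (Icc 0 T)) (hJ : ContDiffOn ℝ 2 J (Icc 0 T))
    (hP0 : ∀ t ∈ Icc 0 T, P 0 t = 1)
    (hP : ∀ t ∈ Icc 0 T, ∀ s, HasDerivAt (fun s => P s t) (D t * P s t) s)
    (hP1 : ∀ t ∈ Icc 0 T, ∀ s, 0 ≤ s → ‖P s t‖ ≤ 1) :
    ∃ C : ℝ, 0 ≤ C ∧ ∀ t h : ℝ, 0 ≤ h → t ∈ Icc 0 T → t + 2 * h ∈ Icc 0 T →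
      ‖P (2 * h) (t + h) + 2 * (P h (t + h) * (h • J (t + h)) * P h t * (1 + h • J t)) -
        (1 + 2 * (h • (D (t + h) + J (t + h))) + 2 * (h • (D (t + h) + J (t + h))) ^ 2)‖
        ≤ C * h ^ 3 ∧
      ∀ ρ : ℝ → E, (∀ t ∈ Icc 0 T, HasDerivWithinAt ρ ((D t + J t) (ρ t)) (Icc 0 T) t) →
        ‖ρ (t + 2 * h) -
          (P (2 * h) (t + h) + 2 * (P h (t + h) * (h • J (t + h)) * P h t * (1 + h • J t))) (ρ t)‖
        ≤ C * ‖ρ 0‖ * h ^ 3 := by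
  obtain ⟨K₁, D', hK₁, hD'⟩ := exists_taylorBound_of_contDiffOn hT hD
  obtain ⟨K₂, J', hK₂, hJ'⟩ := exists_taylorBound_of_contDiffOn hT hJ
  obtain ⟨K₃, L', hK₃, hL'⟩ := exists_taylorBound_of_contDiffOn hT (hD.add hJ)
  set K := K₁ + K₂ with hK
  have hK0 : 0 ≤ K := by positivity
  replace hD' := hD'.mono (K' := K) (by linarith)
  replace hJ' := hJ'.mono (K' := K) (by linarith)
  -- Serves two remainders: `K² h²` at second order for time `h`, and `K³ (2h)³` at third order for
  -- time `2h`.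
  set C₀ := K ^ 2 + 8 * K ^ 3 with hC₀
  have hC₀' : 0 ≤ C₀ := by positivity
  set C₁ := (C₀ + 2 * (C₀ * K * (1 + K * T)) + 2 * ((1 + K * T) * K * C₀ * (1 + K * T)) +
        2 * (K * (K + K)) + 2 * (K * K * K) + 2 * (K * K * (K + K + K * K * T))) with hC₁
  have hC₁' : 0 ≤ C₁ := by positivity
  set C₂ := (2 * K₃ + 6 * K₃ ^ 2 + 6 * K₃ ^ 3) * Real.exp (K₃ * T) with hC₂
  have hC₂' : 0 ≤ C₂ := by positivity
  set C₃ := C₁ * Real.exp (K₃ * T) with hC₃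
  have hC₃' : 0 ≤ C₃ := by positivity
  refine ⟨C₁ + (C₂ + C₃), by positivity, fun t h h0 ht hth => ?_⟩
  have hc : t + h ∈ Icc 0 T := ⟨by linarith [ht.1], by linarith [hth.2]⟩
  have hhT : h ≤ T := by linarith [ht.1, hth.2]
  have hsm : ∀ (A : E →L[ℝ] E) (a : ℝ), ‖A‖ ≤ a → ‖h • A‖ ≤ a * h := fun A a hA => by
    rw [norm_smul, Real.norm_eq_abs, abs_of_nonneg h0, mul_comm]
    gcongr
  have hlip : ∀ (g g' : ℝ → E →L[ℝ] E), TaylorBound (Icc 0 T) K g g' →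
      ‖h • g t - h • g (t + h)‖ ≤ K * h ^ 2 := fun g g' hg => by
    have h1 := hg.lipschitz (t + h) hc t ht
    rw [show t - (t + h) = -h by ring, abs_neg, abs_of_nonneg h0] at h1
    rw [← smul_sub]
    exact (hsm _ _ h1).trans_eq (by ring)
  obtain ⟨-, s1⟩ := norm_semigroup_taylor_le (P := fun s => P s (t + h)) hK0
    (hD'.norm_le _ hc) (hP0 _ hc) (hP _ hc)
    (hP1 _ hc) (s := 2 * h) (by positivity)
  obtain ⟨s2, -⟩ := norm_semigroup_taylor_le (P := fun s => P s (t + h)) hK0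
    (hD'.norm_le _ hc) (hP0 _ hc) (hP _ hc)
    (hP1 _ hc) (s := h) h0
  obtain ⟨s3, -⟩ := norm_semigroup_taylor_le (P := fun s => P s t) hK0
    (hD'.norm_le _ ht) (hP0 _ ht) (hP _ ht)
    (hP1 _ ht) (s := h) h0
  have key : ‖P (2 * h) (t + h) + 2 * (P h (t + h) * (h • J (t + h)) * P h t * (1 + h • J t)) -
        (1 + 2 * (h • (D (t + h) + J (t + h))) + 2 * (h • (D (t + h) + J (t + h))) ^ 2)‖
        ≤ C₁ * h ^ 3 := by
    rw [smul_add]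
    refine norm_midpoint_step_sub_expansion_le (x' := h • D t) ContinuousLinearMap.norm_id_le
      hK0 h0 hhT
      (hsm _ _ (hD'.norm_le _ hc)) (hsm _ _ (hJ'.norm_le _ hc)) (hsm _ _ (hD'.norm_le _ ht))
      (hsm _ _ (hJ'.norm_le _ ht)) (hP1 t ht h h0) ?_ ?_ ?_ (hlip _ _ hD') (hlip _ _ hJ')
    · have e : P (2 * h) (t + h) - 1 - 2 * (h • D (t + h)) - 2 * (h • D (t + h)) ^ 2
          = P (2 * h) (t + h) - 1 - (2 * h) • D (t + h) - ((2 * h) ^ 2 / 2) • D (t + h) ^ 2 := by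
        rw [smul_pow]
        simp only [two_mul]
        module
      rw [e]
      refine s1.trans ?_
      rw [hC₀]
      nlinarith [pow_nonneg h0 3, mul_nonneg (sq_nonneg K) (pow_nonneg h0 3)]
    · exact s2.trans (mul_le_mul_of_nonneg_right (by rw [hC₀]; linarith [pow_nonneg hK0 3])
        (sq_nonneg h))
    · exact s3.trans (mul_le_mul_of_nonneg_right (by rw [hC₀]; linarith [pow_nonneg hK0 3])
        (sq_nonneg h))
  have hh3 : 0 ≤ h ^ 3 := by positivity
  -- The operator estimate is kept as a conclusion because it also controls the trace of `Φ` on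
  -- arbitrary matrices, not only along solutions.
  refine ⟨key.trans (mul_le_mul_of_nonneg_right (by linarith) hh3), fun ρ hρ => ?_⟩
  have hR := norm_solution_le (𝓛 := fun t => D t + J t) hL'.norm_le hρ hK₃
  have hex := norm_solution_sub_midpoint_expansion_le (𝓛 := fun t => D t + J t) ordConnected_Icc
    hK₃ (by positivity) hL' hρ hR h0 ht hth
  set S := P (2 * h) (t + h) + 2 * (P h (t + h) * (h • J (t + h)) * P h t * (1 + h • J t)) with hS
  set Q : E →L[ℝ] E :=
    1 + 2 * (h • (D (t + h) + J (t + h))) + 2 * (h • (D (t + h) + J (t + h))) ^ 2 with hQ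
  have e : ρ (t + 2 * h) - S (ρ t) = (ρ (t + 2 * h) - Q (ρ t)) - (S - Q) (ρ t) := by
    rw [sub_apply]
    abel
  rw [e]
  calc _ ≤ ‖ρ (t + 2 * h) - Q (ρ t)‖ + ‖(S - Q) (ρ t)‖ := norm_sub_le _ _
    _ ≤ (2 * K₃ + 6 * K₃ ^ 2 + 6 * K₃ ^ 3) * (Real.exp (K₃ * T) * ‖ρ 0‖) * h ^ 3 +
        C₁ * h ^ 3 * (Real.exp (K₃ * T) * ‖ρ 0‖) :=
        add_le_add hex ((S - Q).le_of_opNorm_le_of_le key (hR t ht))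
    _ = (C₂ + C₃) * ‖ρ 0‖ * h ^ 3 := by rw [hC₂, hC₃]; ring
    _ ≤ _ := mul_le_mul_of_nonneg_right
        (mul_le_mul_of_nonneg_right (by linarith) (norm_nonneg _)) hh3

end Calculus

/-! ### Contraction semigroups of matrices -/

section Matrices

open scoped Matrix.Norms.L2Operator
open Set

variable {m K : ℕ}

/-- The operator norm makes the matrices a normed algebra over the reals. -/
@[reducible]
def l2OpNormedAlgebraReal : NormedAlgebra ℝ (Matrix (Fin m) (Fin m) ℂ) where
  norm_smul_le r M := by
    have h : r • M = (r : ℂ) • M := by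
      ext i j
      simp
    rw [h]
    exact (norm_smul_le _ _).trans_eq (by simp)

attribute [local instance] l2OpNormedAlgebraReal
attribute [local irreducible] traceNorm

theorem hasDerivAt_exp_smul_matrix (B : Matrix (Fin m) (Fin m) ℂ) (s : ℝ) :
    HasDerivAt (fun u : ℝ => NormedSpace.exp (u • B)) (B * NormedSpace.exp (s • B)) s :=
  hasDerivAt_exp_smul_const' (𝕂 := ℝ) B s

theorem hasDerivAt_exp_smul_matrix' (B : Matrix (Fin m) (Fin m) ℂ) (s : ℝ) :
    HasDerivAt (fun u : ℝ => NormedSpace.exp (u • B)) (NormedSpace.exp (s • B) * B) s :=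
  hasDerivAt_exp_smul_const (𝕂 := ℝ) B s

theorem exp_smul_conjTranspose (B : Matrix (Fin m) (Fin m) ℂ) (s : ℝ) :
    NormedSpace.exp (s • Bᴴ) = (NormedSpace.exp (s • B))ᴴ := by
  rw [← Matrix.exp_conjTranspose, Matrix.conjTranspose_smul, star_trivial]

/-- The real part of the quadratic form of a matrix at a vector, as a functional of the matrix. -/
def reQuadForm (x : Fin m → ℂ) : Matrix (Fin m) (Fin m) ℂ →ₗ[ℝ] ℝ where
  toFun M := (star x ⬝ᵥ M *ᵥ x).re
  map_add' M N := by simp [Matrix.add_mulVec, dotProduct_add]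
  map_smul' r M := by simp [Matrix.smul_mulVec, dotProduct_smul]

theorem reQuadForm_apply (x : Fin m → ℂ) (M : Matrix (Fin m) (Fin m) ℂ) :
    reQuadForm x M = (star x ⬝ᵥ M *ᵥ x).re := rfl

theorem reQuadForm_conj (x : Fin m → ℂ) (M U : Matrix (Fin m) (Fin m) ℂ) :
    reQuadForm x (Uᴴ * M * U) = reQuadForm (U *ᵥ x) M := by
  simp only [reQuadForm_apply]
  rw [← Matrix.mulVec_mulVec, ← Matrix.mulVec_mulVec, Matrix.star_mulVec,
    Matrix.dotProduct_mulVec, Matrix.dotProduct_mulVec, Matrix.dotProduct_mulVec]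

theorem norm_toLp_sq_eq_reQuadForm (x : Fin m → ℂ) :
    ‖(WithLp.toLp 2 x : EuclideanSpace ℂ (Fin m))‖ ^ 2 = reQuadForm x 1 := by
  rw [EuclideanSpace.norm_sq_eq, reQuadForm_apply, Matrix.one_mulVec, dotProduct, Complex.re_sum]
  refine Finset.sum_congr rfl fun i _ => ?_
  rw [← Complex.normSq_eq_norm_sq, Complex.normSq_apply]
  simp

/-- A dissipative matrix generates a contraction semigroup. -/
theorem norm_exp_smul_le_one {B : Matrix (Fin m) (Fin m) ℂ} (hB : (-(B + Bᴴ)).PosSemidef) {s : ℝ}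
    (hs : 0 ≤ s) : ‖NormedSpace.exp (s • B)‖ ≤ 1 := by
  have key : ∀ x : Fin m → ℂ, ‖(WithLp.toLp 2 (NormedSpace.exp (s • B) *ᵥ x) :
      EuclideanSpace ℂ (Fin m))‖ ≤ ‖(WithLp.toLp 2 x : EuclideanSpace ℂ (Fin m))‖ := by
    intro x
    set ψ : Matrix (Fin m) (Fin m) ℂ →L[ℝ] ℝ := (reQuadForm x).toContinuousLinearMap with hψ
    -- The function is `‖exp (u B) x‖²`; its derivative is the quadratic form of `B + Bᴴ` at `exp (u
    -- B) x`, which dissipativity makes nonpositive.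
    have hder : ∀ u : ℝ, HasDerivAt
        (fun u : ℝ => ψ ((NormedSpace.exp (u • B))ᴴ * NormedSpace.exp (u • B)))
        (reQuadForm (NormedSpace.exp (u • B) *ᵥ x) (B + Bᴴ)) u := by
      intro u
      have h1 := (hasDerivAt_exp_smul_matrix' Bᴴ u).mul (hasDerivAt_exp_smul_matrix B u)
      have h2 := ψ.hasFDerivAt.comp_hasDerivAt u h1
      have h3 : (fun u : ℝ => ψ ((NormedSpace.exp (u • B))ᴴ * NormedSpace.exp (u • B)))
          = ψ ∘ ((fun u : ℝ => NormedSpace.exp (u • Bᴴ)) *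
            fun u : ℝ => NormedSpace.exp (u • B)) := by
        funext u
        simp only [Function.comp_apply, Pi.mul_apply, exp_smul_conjTranspose]
      rw [h3]
      refine h2.congr_deriv ?_
      rw [← reQuadForm_conj, exp_smul_conjTranspose, hψ]
      change reQuadForm x _ = _
      congr 1
      rw [Matrix.mul_add, Matrix.add_mul]
      simp only [Matrix.mul_assoc]
      rw [add_comm]
    have hanti : Antitone
        (fun u : ℝ => ψ ((NormedSpace.exp (u • B))ᴴ * NormedSpace.exp (u • B))) :=
      antitone_of_hasDerivAt_nonpos hder fun u => by
        rw [Pi.zero_apply]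
        have h := hB.dotProduct_mulVec_nonneg (NormedSpace.exp (u • B) *ᵥ x)
        have h' := (Complex.le_def.1 h).1
        rw [← reQuadForm_apply, map_neg] at h'
        rw [map_add]
        simp only [map_add, Complex.zero_re] at h'
        linarith
    have h0 := hanti hs
    have h1 : ∀ U : Matrix (Fin m) (Fin m) ℂ, ψ (Uᴴ * U) = reQuadForm (U *ᵥ x) 1 := fun U => by
      rw [← reQuadForm_conj, Matrix.mul_one]
      rfl
    simp only [h1, zero_smul, NormedSpace.exp_zero, Matrix.one_mulVec,
      ← norm_toLp_sq_eq_reQuadForm] at h0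
    exact le_of_sq_le_sq h0 (norm_nonneg _)
  rw [Matrix.cstar_norm_def]
  refine ContinuousLinearMap.opNorm_le_bound _ zero_le_one fun x => ?_
  rw [one_mul]
  exact key x.ofLp

theorem traceNorm_mul_mul_conjTranspose_le (L X : Matrix (Fin m) (Fin m) ℂ) :
    traceNorm (L * X * Lᴴ) ≤ traceNorm L ^ 2 * traceNorm X := by
  have hX := traceNorm_nonneg X
  have hL := traceNorm_nonneg L
  have h1 := norm_le_traceNorm L
  have h2 : ‖Lᴴ‖ ≤ traceNorm L := (Matrix.l2_opNorm_conjTranspose L).trans_le h1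
  calc _ ≤ ‖L‖ * traceNorm X * ‖Lᴴ‖ := traceNorm_mul_mul_le _ _ _
    _ ≤ traceNorm L * traceNorm X * traceNorm L := by gcongr
    _ = _ := by ring

end Matrices

/-! ### The Lindblad generator and the full-rank scheme -/

namespace System

open scoped Matrix.Norms.L2Operator
open Set

attribute [local instance] l2OpNormedAlgebraReal
attribute [local irreducible] traceNorm

variable {m K : ℕ} (S : System m K)

/-- The map `X ↦ A(t) X + X A(t)ᴴ`. -/
def drift (t : ℝ) : Matrix (Fin m) (Fin m) ℂ →L[ℝ] Matrix (Fin m) (Fin m) ℂ :=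
  ContinuousLinearMap.mulLeftRight ℝ _ (S.A t) 1 + ContinuousLinearMap.mulLeftRight ℝ _ 1 (S.A t)ᴴ

/-- The jump part of the generator as a continuous linear map. -/
def jumpCLM (t : ℝ) : Matrix (Fin m) (Fin m) ℂ →L[ℝ] Matrix (Fin m) (Fin m) ℂ :=
  ∑ k, S.γ k t • ContinuousLinearMap.mulLeftRight ℝ _ (S.L k) (S.L k)ᴴ

/-- The map `X ↦ exp(s A(t)) X exp(s A(t)ᴴ)`. -/
def driftSemigroup (s t : ℝ) : Matrix (Fin m) (Fin m) ℂ →L[ℝ] Matrix (Fin m) (Fin m) ℂ :=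
  ContinuousLinearMap.mulLeftRight ℝ _ (NormedSpace.exp (s • S.A t))
    (NormedSpace.exp (s • (S.A t)ᴴ))

theorem drift_apply (t : ℝ) (X : Matrix (Fin m) (Fin m) ℂ) :
    S.drift t X = S.A t * X + X * (S.A t)ᴴ := by
  simp [drift]

theorem jumpCLM_apply (t : ℝ) (X : Matrix (Fin m) (Fin m) ℂ) :
    S.jumpCLM t X = S.jump t X := by
  simp [jumpCLM, jump]

theorem driftSemigroup_apply (s t : ℝ) (X : Matrix (Fin m) (Fin m) ℂ) :
    S.driftSemigroup s t X =
      NormedSpace.exp (s • S.A t) * X * NormedSpace.exp (s • (S.A t)ᴴ) := by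
  simp [driftSemigroup]

/-- The Hamiltonian part is skew-Hermitian and drops out. What is left gives dissipativity when `γ ≥
0`, and balances the trace of the jump part. -/
theorem A_add_conjTranspose {t : ℝ} (hH : (S.H t).IsHermitian) :
    S.A t + (S.A t)ᴴ = -∑ k, S.γ k t • ((S.L k)ᴴ * S.L k) := by
  have h1 : (∑ k, S.γ k t • ((S.L k)ᴴ * S.L k))ᴴ = ∑ k, S.γ k t • ((S.L k)ᴴ * S.L k) := by
    rw [Matrix.conjTranspose_sum]
    refine Finset.sum_congr rfl fun k _ => ?_
    rw [Matrix.conjTranspose_smul, star_trivial, Matrix.conjTranspose_mul,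
      Matrix.conjTranspose_conjTranspose]
  rw [A, Matrix.conjTranspose_sub, Matrix.conjTranspose_neg, Matrix.conjTranspose_smul,
    Matrix.conjTranspose_smul, h1, hH.eq, star_trivial (1 / 2 : ℝ)]
  have h2 : star Complex.I = -Complex.I := by simp
  rw [h2]
  module

theorem trace_drift_add_jump {t : ℝ} (hH : (S.H t).IsHermitian) (X : Matrix (Fin m) (Fin m) ℂ) :
    (S.drift t X + S.jump t X).trace = 0 := by
  have h1 : (S.jump t X).trace = ((∑ k, S.γ k t • ((S.L k)ᴴ * S.L k)) * X).trace := by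
    rw [jump, Matrix.trace_sum, Finset.sum_mul, Matrix.trace_sum]
    refine Finset.sum_congr rfl fun k _ => ?_
    rw [Matrix.trace_smul, Matrix.smul_mul, Matrix.trace_smul, Matrix.trace_mul_comm,
      Matrix.mul_assoc]
  have h2 : (S.drift t X).trace = ((S.A t + (S.A t)ᴴ) * X).trace := by
    rw [drift_apply, Matrix.trace_add, Matrix.add_mul, Matrix.trace_add,
      Matrix.trace_mul_comm X]
  rw [Matrix.trace_add, h1, h2, S.A_add_conjTranspose hH, ← Matrix.trace_add, ← Matrix.add_mul]
  simp

theorem exp_conj (s t : ℝ) :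
    NormedSpace.exp (s • (S.A t)ᴴ) = (NormedSpace.exp (s • S.A t))ᴴ :=
  exp_smul_conjTranspose _ _

/-- Puts the step in the form of `exists_midpoint_consistency` with `h = τ / 2`, and makes its
linearity available. -/
theorem Φ_eq (τ t : ℝ) (X : Matrix (Fin m) (Fin m) ℂ) :
    S.Φ τ t X = (S.driftSemigroup (2 * (τ / 2)) (t + τ / 2) +
      2 * (S.driftSemigroup (τ / 2) (t + τ / 2) * ((τ / 2) • S.jumpCLM (t + τ / 2)) *
        S.driftSemigroup (τ / 2) t * (1 + (τ / 2) • S.jumpCLM t))) X := by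
  have h1 : S.driftSemigroup (τ / 2) t ((1 + (τ / 2) • S.jumpCLM t) X) = S.halfStep τ t X := by
    rw [driftSemigroup_apply, halfStep, add_apply, smul_apply, jumpCLM_apply,
      one_apply_eq_self]
  have h2 : ∀ Z : Matrix (Fin m) (Fin m) ℂ →L[ℝ] Matrix (Fin m) (Fin m) ℂ,
      (2 * Z) X = (2 : ℝ) • Z X := fun Z => by
    rw [two_mul, add_apply, two_smul]
  rw [add_apply, h2]
  simp only [mul_apply_eq_comp]
  rw [h1, smul_apply, map_smul, smul_smul, jumpCLM_apply, driftSemigroup_apply,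
    driftSemigroup_apply, Φ, mul_div_cancel₀ τ (two_ne_zero' ℝ)]

variable {S} {T : ℝ}

namespace Admissible

theorem norm_exp_le_one (hS : S.Admissible T) {s t : ℝ} (ht : t ∈ Icc 0 T) (hs : 0 ≤ s) :
    ‖NormedSpace.exp (s • S.A t)‖ ≤ 1 := by
  refine norm_exp_smul_le_one ?_ hs
  rw [S.A_add_conjTranspose (hS.isHermitian t ht), neg_neg]
  refine Matrix.posSemidef_sum _ fun k _ => ?_
  exact (Matrix.posSemidef_conjTranspose_mul_self _).smul (hS.nonneg k t ht)

theorem norm_exp_conj_le_one (hS : S.Admissible T) {s t : ℝ} (ht : t ∈ Icc 0 T) (hs : 0 ≤ s) :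
    ‖NormedSpace.exp (s • (S.A t)ᴴ)‖ ≤ 1 := by
  rw [S.exp_conj, Matrix.l2_opNorm_conjTranspose]
  exact hS.norm_exp_le_one ht hs

theorem contDiffOn_A (hS : S.Admissible T) : ContDiffOn ℝ 2 S.A (Icc 0 T) := by
  have hH : ContDiffOn ℝ 2 S.H (Icc 0 T) := by
    have h1 : ContDiffOn ℝ 2 (fun t => fun i j => S.H t i j) (Icc 0 T) :=
      contDiffOn_pi.2 fun i => contDiffOn_pi.2 fun j => hS.contDiffOn_H i j
    have h2 := (Matrix.ofLinearEquiv (m := Fin m) (n := Fin m) (α := ℂ) ℝ).toLinearMap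
      |>.toContinuousLinearMap.contDiff (n := 2) |>.comp_contDiffOn h1
    exact h2
  have h1 : ContDiffOn ℝ 2 (fun t => Complex.I • S.H t) (Icc 0 T) := by
    have h2 := (LinearMap.mulLeft ℝ (Complex.I • (1 : Matrix (Fin m) (Fin m) ℂ)))
      |>.toContinuousLinearMap.contDiff (n := 2) |>.comp_contDiffOn hH
    refine h2.congr fun t _ => ?_
    simp
  have h2 : ContDiffOn ℝ 2 (fun t => ∑ k, S.γ k t • ((S.L k)ᴴ * S.L k)) (Icc 0 T) :=
    ContDiffOn.sum fun k _ => (hS.contDiffOn_γ k).smul contDiffOn_const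
  exact h1.neg.sub (h2.const_smul (1 / 2 : ℝ))

theorem contDiffOn_drift (hS : S.Admissible T) : ContDiffOn ℝ 2 S.drift (Icc 0 T) := by
  have h1 : ContDiffOn ℝ 2 (fun t => (S.A t)ᴴ) (Icc 0 T) :=
    (Matrix.conjTransposeLinearEquiv (Fin m) (Fin m) ℝ ℂ).toLinearMap
      |>.toContinuousLinearMap.contDiff (n := 2) |>.comp_contDiffOn hS.contDiffOn_A
  have h2 := (ContinuousLinearMap.mulLeftRight ℝ (Matrix (Fin m) (Fin m) ℂ)).flip 1
    |>.contDiff (n := 2) |>.comp_contDiffOn hS.contDiffOn_A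
  have h3 := ContinuousLinearMap.mulLeftRight ℝ (Matrix (Fin m) (Fin m) ℂ) 1
    |>.contDiff (n := 2) |>.comp_contDiffOn h1
  exact h2.add h3

theorem contDiffOn_jumpCLM (hS : S.Admissible T) : ContDiffOn ℝ 2 S.jumpCLM (Icc 0 T) :=
  ContDiffOn.sum fun k _ => (hS.contDiffOn_γ k).smul contDiffOn_const

theorem norm_driftSemigroup_le_one (hS : S.Admissible T) {s t : ℝ} (ht : t ∈ Icc 0 T) (hs : 0 ≤ s) :
    ‖S.driftSemigroup s t‖ ≤ 1 :=
  (ContinuousLinearMap.opNorm_mulLeftRight_apply_apply_le _ _ _ _).trans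
    (mul_le_one₀ (hS.norm_exp_le_one ht hs) (norm_nonneg _) (hS.norm_exp_conj_le_one ht hs))

theorem hasDerivAt_driftSemigroup (s t : ℝ) :
    HasDerivAt (fun s => S.driftSemigroup s t) (S.drift t * S.driftSemigroup s t) s := by
  have h2 := (ContinuousLinearMap.mulLeftRight ℝ (Matrix (Fin m) (Fin m) ℂ)).hasDerivAt_of_bilinear
    (fun _ => hasDerivAt_exp_smul_matrix (S.A t) s)
    (fun _ => hasDerivAt_exp_smul_matrix' (S.A t)ᴴ s)
  refine h2.congr_deriv ?_
  ext1 X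
  simp only [mul_apply_eq_comp, S.drift_apply, S.driftSemigroup_apply, add_apply,
    ContinuousLinearMap.mulLeftRight_apply]
  simp only [Matrix.mul_assoc]
  rw [add_comm]

/-- The consistency of the full-rank exponential midpoint scheme, together with its almost
preservation of the trace. -/
theorem exists_truncationConstant (hS : S.Admissible T) (hT : 0 < T) :
    ∃ C₁ : ℝ, 0 < C₁ ∧ S.IsTruncationConstant T C₁ ∧
      ∀ t τ : ℝ, 0 ≤ τ → t ∈ Icc 0 T → t + τ ∈ Icc 0 T → ∀ X : Matrix (Fin m) (Fin m) ℂ,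
        ‖(S.Φ τ t X).trace - X.trace‖ ≤ C₁ * τ ^ 3 * traceNorm X := by
  obtain ⟨C, hC, h⟩ := exists_midpoint_consistency hT hS.contDiffOn_drift hS.contDiffOn_jumpCLM
    (P := S.driftSemigroup)
    (fun t _ => by
      ext1 X
      rw [S.driftSemigroup_apply, zero_smul, zero_smul, NormedSpace.exp_zero, Matrix.mul_one,
        Matrix.one_mul, one_apply_eq_self])
    (fun t _ s => hasDerivAt_driftSemigroup s t)
    (fun t ht s hs => hS.norm_driftSemigroup_le_one ht hs)
  have hmC : 0 ≤ m * C := by positivity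
  -- The factor `m` converts the operator norm into the trace norm; the `1` keeps the constant
  -- positive when `m * C = 0`.
  refine ⟨m * C + 1, by positivity, ?_, ?_⟩
  · intro ρ₀ ρ hρ₀ hρ N τ hN hτ n hn
    have hN' : (0 : ℝ) < N := by exact_mod_cast hN
    have hτ0 : 0 ≤ τ := by rw [hτ]; positivity
    have hNτ : N * τ = T := by rw [hτ]; field_simp
    have hn' : (n : ℝ) + 1 ≤ N := by exact_mod_cast hn
    have ht : n * τ ∈ Icc 0 T := ⟨by positivity, by rw [← hNτ]; gcongr⟩
    have ht' : n * τ + 2 * (τ / 2) ∈ Icc 0 T :=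
      ⟨by positivity, by rw [← hNτ]; nlinarith⟩
    have h1 := (h (n * τ) (τ / 2) (by positivity) ht ht').2 ρ fun t ht => by
      rw [add_apply, S.drift_apply, S.jumpCLM_apply]
      exact hρ.2 t ht
    rw [← S.Φ_eq, hρ.1, show n * τ + 2 * (τ / 2) = (n + 1) * τ by ring] at h1
    have h2 : ‖ρ₀‖ ≤ 1 := (norm_le_traceNorm _).trans (traceNorm_of_isDensity hρ₀).le
    calc _ ≤ m * ‖ρ ((n + 1) * τ) - S.Φ τ (n * τ) (ρ (n * τ))‖ := traceNorm_le_mul_norm _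
      _ ≤ m * (C * 1 * (τ / 2) ^ 3) := by
          gcongr
          refine h1.trans ?_
          gcongr
      _ ≤ (m * C + 1) * τ ^ 3 := by
          have := pow_nonneg hτ0 3
          nlinarith [mul_nonneg hmC this]
  · intro t τ hτ ht ht' X
    have hc : t + τ / 2 ∈ Icc 0 T := ⟨by linarith [ht.1], by linarith [ht'.2]⟩
    have h1 := (h t (τ / 2) (by positivity) ht (by rwa [mul_div_cancel₀ τ (two_ne_zero' ℝ)])).1
    set M := (τ / 2) • (S.drift (t + τ / 2) + S.jumpCLM (t + τ / 2)) with hM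
    have hMtr : ∀ Y, (M Y).trace = 0 := fun Y => by
      rw [hM, smul_apply, Matrix.trace_smul, add_apply, S.jumpCLM_apply,
        S.trace_drift_add_jump (hS.isHermitian _ hc), smul_zero]
    have h2 := ContinuousLinearMap.le_of_opNorm_le _ h1 X
    rw [sub_apply, ← S.Φ_eq] at h2
    -- The range of `M` is traceless, so only the identity contributes and the polynomial preserves
    -- the trace exactly.
    have h3 : ((1 + 2 * M + 2 * M ^ 2 :
        Matrix (Fin m) (Fin m) ℂ →L[ℝ] Matrix (Fin m) (Fin m) ℂ) X).trace = X.trace := by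
      rw [two_mul, two_mul, pow_two]
      simp only [add_apply, mul_apply_eq_comp, one_apply_eq_self, Matrix.trace_add, hMtr, add_zero]
    rw [← h3, ← Matrix.trace_sub]
    refine ((norm_trace_le _).trans (traceNorm_le_mul_norm _)).trans ?_
    calc _ ≤ m * (C * (τ / 2) ^ 3 * traceNorm X) := by
          gcongr
          refine h2.trans ?_
          gcongr
          exact norm_le_traceNorm X
      _ ≤ (m * C + 1) * τ ^ 3 * traceNorm X := by
          have h4 := traceNorm_nonneg X
          have h5 := pow_nonneg hτ 3
          rw [← mul_assoc]
          refine mul_le_mul_of_nonneg_right ?_ h4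
          nlinarith [mul_nonneg hmC h5]

theorem sum_gamma_mul_le (hS : S.Admissible T) {t : ℝ} (ht : t ∈ Icc 0 T) :
    ∑ k, S.γ k t * traceNorm (S.L k) ^ 2 ≤ S.C₂ T := by
  refine Finset.sum_le_sum fun k _ => mul_le_mul_of_nonneg_right ?_ (sq_nonneg _)
  exact le_csSup (isCompact_Icc.image_of_continuousOn (hS.contDiffOn_γ k).continuousOn).bddAbove
    (mem_image_of_mem _ ht)

theorem C₂_nonneg (hS : S.Admissible T) (hT : 0 ≤ T) : 0 ≤ S.C₂ T :=
  (Finset.sum_nonneg fun k _ => mul_nonneg (hS.nonneg k 0 ⟨le_rfl, hT⟩) (sq_nonneg _)).trans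
    (hS.sum_gamma_mul_le ⟨le_rfl, hT⟩)

theorem traceNorm_jump_le (hS : S.Admissible T) {t : ℝ} (ht : t ∈ Icc 0 T) (X : Matrix (Fin m) (Fin m) ℂ) :
    traceNorm (S.jump t X) ≤ S.C₂ T * traceNorm X := by
  have hX := traceNorm_nonneg X
  calc traceNorm (S.jump t X) ≤ ∑ k, traceNorm (S.γ k t • (S.L k * X * (S.L k)ᴴ)) := by
        rw [jump]
        exact traceNorm_sum_le _ _
    _ ≤ ∑ k, S.γ k t * traceNorm (S.L k) ^ 2 * traceNorm X := by
        refine Finset.sum_le_sum fun k _ => (traceNorm_smul_le _ _).trans ?_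
        rw [abs_of_nonneg (hS.nonneg k t ht), mul_assoc (S.γ k t)]
        exact mul_le_mul_of_nonneg_left (traceNorm_mul_mul_conjTranspose_le _ _)
          (hS.nonneg k t ht)
    _ ≤ S.C₂ T * traceNorm X := by
        rw [← Finset.sum_mul]
        exact mul_le_mul_of_nonneg_right (hS.sum_gamma_mul_le ht) hX

theorem traceNorm_exp_conj_le (hS : S.Admissible T) {s t : ℝ} (ht : t ∈ Icc 0 T) (hs : 0 ≤ s)
    (X : Matrix (Fin m) (Fin m) ℂ) :
    traceNorm (NormedSpace.exp (s • S.A t) * X * NormedSpace.exp (s • (S.A t)ᴴ)) ≤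
      traceNorm X := by
  have hX := traceNorm_nonneg X
  refine (traceNorm_mul_mul_le _ _ _).trans ?_
  calc _ ≤ 1 * traceNorm X * 1 := by
        gcongr
        · exact hS.norm_exp_le_one ht hs
        · exact hS.norm_exp_conj_le_one ht hs
    _ = _ := by ring

theorem traceNorm_smul_jump_le (hS : S.Admissible T) {t s : ℝ} (ht : t ∈ Icc 0 T) (hs : 0 ≤ s)
    (X : Matrix (Fin m) (Fin m) ℂ) :
    traceNorm (s • S.jump t X) ≤ s * S.C₂ T * traceNorm X := by
  refine (traceNorm_smul_le _ _).trans ?_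
  rw [abs_of_nonneg hs, mul_assoc]
  exact mul_le_mul_of_nonneg_left (hS.traceNorm_jump_le ht X) hs

theorem traceNorm_halfStep_le (hS : S.Admissible T) {t τ : ℝ} (ht : t ∈ Icc 0 T) (hτ : 0 ≤ τ)
    (X : Matrix (Fin m) (Fin m) ℂ) :
    traceNorm (S.halfStep τ t X) ≤ (1 + τ / 2 * S.C₂ T) * traceNorm X := by
  have hτ2 : 0 ≤ τ / 2 := by positivity
  refine (hS.traceNorm_exp_conj_le ht hτ2 _).trans ((traceNorm_add_le _ _).trans ?_)
  linarith [hS.traceNorm_smul_jump_le ht hτ2 X]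

theorem traceNorm_Φ_le (hS : S.Admissible T) {t τ : ℝ} (ht : t ∈ Icc 0 T) (ht' : t + τ / 2 ∈ Icc 0 T) (hτ : 0 ≤ τ)
    (X : Matrix (Fin m) (Fin m) ℂ) :
    traceNorm (S.Φ τ t X) ≤ (1 + τ * (S.C₂ T * (1 + τ / 2 * S.C₂ T))) * traceNorm X := by
  have hτ2 : 0 ≤ τ / 2 := by positivity
  have hC := hS.C₂_nonneg (ht.1.trans ht.2)
  have h1 := hS.traceNorm_exp_conj_le ht' hτ X
  have h2 : traceNorm (τ • (NormedSpace.exp ((τ / 2) • S.A (t + τ / 2)) *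
      S.jump (t + τ / 2) (S.halfStep τ t X) * NormedSpace.exp ((τ / 2) • (S.A (t + τ / 2))ᴴ)))
      ≤ τ * (S.C₂ T * ((1 + τ / 2 * S.C₂ T) * traceNorm X)) := by
    refine (traceNorm_smul_le _ _).trans ?_
    rw [abs_of_nonneg hτ]
    gcongr
    refine (hS.traceNorm_exp_conj_le ht' hτ2 _).trans ((hS.traceNorm_jump_le ht' _).trans ?_)
    gcongr
    exact hS.traceNorm_halfStep_le ht hτ X
  refine (traceNorm_add_le _ _).trans ((add_le_add h1 h2).trans_eq ?_)
  ring

end Admissible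

end System

/-! ### Error propagation through one low-rank step -/

section LowRank

attribute [local irreducible] traceNorm frobNorm

theorem fromCols_mul_conjTranspose {m : ℕ} {α β : Type*} [Fintype α] [Fintype β]
    (A : Matrix (Fin m) α ℂ) (B : Matrix (Fin m) β ℂ) :
    Matrix.fromCols A B * (Matrix.fromCols A B)ᴴ = A * Aᴴ + B * Bᴴ := by
  rw [Matrix.conjTranspose_fromCols_eq_fromRows_conjTranspose, Matrix.fromCols_mul_fromRows]

theorem smul_mul_conjTranspose_smul {m : ℕ} {α : Type*} [Fintype α] (c : ℝ)
    (A : Matrix (Fin m) α ℂ) : (c • A) * (c • A)ᴴ = (c ^ 2) • (A * Aᴴ) := by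
  rw [Matrix.conjTranspose_smul, star_trivial, Matrix.smul_mul, Matrix.mul_smul, smul_smul, sq]

theorem mul_mul_conjTranspose_mul {m : ℕ} {α : Type*} [Fintype α] (e : Matrix (Fin m) (Fin m) ℂ)
    (A : Matrix (Fin m) α ℂ) : (e * A) * (e * A)ᴴ = e * (A * Aᴴ) * eᴴ := by
  rw [Matrix.conjTranspose_mul]
  simp only [Matrix.mul_assoc]

theorem frobNorm_smul_sq {m : ℕ} {α : Type*} [Fintype α] (c : ℝ) (A : Matrix (Fin m) α ℂ) :
    frobNorm (c • A) ^ 2 = c ^ 2 * frobNorm A ^ 2 := by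
  have h := trace_mul_conjTranspose_eq_frobNorm_sq (c • A)
  rw [smul_mul_conjTranspose_smul, Matrix.trace_smul, trace_mul_conjTranspose_eq_frobNorm_sq,
    Complex.real_smul] at h
  exact_mod_cast h.symm

/-- The error of normalizing a low-rank factor. -/
theorem traceNorm_sub_normalized_le {m : ℕ} {α : Type*} [Fintype α] (A : Matrix (Fin m) α ℂ) :
    traceNorm (A * Aᴴ - ((frobNorm A)⁻¹ • A) * ((frobNorm A)⁻¹ • A)ᴴ) ≤ |frobNorm A ^ 2 - 1| := by
  set f := frobNorm A with hf
  have h1 : A * Aᴴ - (f⁻¹ • A) * (f⁻¹ • A)ᴴ = (1 - f⁻¹ ^ 2) • (A * Aᴴ) := by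
    rw [smul_mul_conjTranspose_smul, sub_smul, one_smul]
  rw [h1]
  refine (traceNorm_smul_le _ _).trans ?_
  rw [traceNorm_mul_conjTranspose, ← hf]
  -- With `0⁻¹ = 0` a vanishing factor stays zero, and the left side is zero.
  by_cases h0 : f = 0
  · simp [h0]
  · rw [← abs_of_nonneg (sq_nonneg f), ← abs_mul, abs_of_nonneg (sq_nonneg f)]
    apply le_of_eq
    congr 1
    field_simp

/-- Discrete Gronwall from `1 + x ≤ exp x`. Keeping `n * y` in place of a geometric sum avoids
division by `x`, which may be zero. -/
theorem le_exp_mul_of_recurrence {N : ℕ} {u : ℕ → ℝ} {x y : ℝ} (hx : 0 ≤ x) (hy : 0 ≤ y)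
    (h0 : 0 ≤ u 0) (h : ∀ n < N, u (n + 1) ≤ (1 + x) * u n + y) :
    ∀ n ≤ N, u n ≤ Real.exp (n * x) * (u 0 + n * y) := by
  intro n
  induction n with
  | zero => simp
  | succ n ih =>
    intro hn
    have h1 := h n hn
    have h2 := ih (Nat.le_of_succ_le hn)
    have h3 : 0 ≤ u 0 + n * y := by positivity
    have h4 : 1 + x ≤ Real.exp x := by linarith [Real.add_one_le_exp x]
    have h5 : Real.exp (((n + 1 : ℕ) : ℝ) * x) = Real.exp x * Real.exp (n * x) := by
      rw [← Real.exp_add]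
      congr 1
      push_cast
      ring
    have h6 : 1 ≤ Real.exp x * Real.exp (n * x) := by
      rw [← h5]
      exact Real.one_le_exp (by positivity)
    rw [h5]
    calc u (n + 1) ≤ (1 + x) * (Real.exp (n * x) * (u 0 + n * y)) + y := by
          refine h1.trans ?_
          gcongr
      _ ≤ Real.exp x * (Real.exp (n * x) * (u 0 + n * y)) + Real.exp x * Real.exp (n * x) * y := by
          gcongr
          exact le_mul_of_one_le_left hy h6
      _ = _ := by
          push_cast
          ring

namespace System

variable {m K : ℕ} {S : System m K} {T : ℝ}

theorem channelFactor_mul_conjTranspose {κ : Type*} [Fintype κ] {τ t : ℝ} (hτ : 0 ≤ τ)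
    (hγ : ∀ k, 0 ≤ S.γ k t) (X : Matrix (Fin m) κ ℂ) :
    S.channelFactor τ t X * (S.channelFactor τ t X)ᴴ = τ • S.jump t (X * Xᴴ) := by
  have h : ∀ k, (√(τ * S.γ k t) • (S.L k * X)) * (√(τ * S.γ k t) • (S.L k * X))ᴴ
      = τ • S.γ k t • (S.L k * (X * Xᴴ) * (S.L k)ᴴ) := fun k => by
    rw [smul_mul_conjTranspose_smul, mul_mul_conjTranspose_mul, smul_smul,
      Real.sq_sqrt (mul_nonneg hτ (hγ k))]
  rw [jump, Finset.smul_sum]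
  simp only [← h]
  ext i j
  rw [Matrix.mul_apply, Fintype.sum_prod_type, Matrix.sum_apply]
  rfl

theorem jump_sub (t : ℝ) (X Y : Matrix (Fin m) (Fin m) ℂ) :
    S.jump t (X - Y) = S.jump t X - S.jump t Y := by
  rw [← S.jumpCLM_apply, map_sub, S.jumpCLM_apply, S.jumpCLM_apply]

theorem Φ_sub (τ t : ℝ) (X Y : Matrix (Fin m) (Fin m) ℂ) :
    S.Φ τ t (X - Y) = S.Φ τ t X - S.Φ τ t Y := by
  rw [S.Φ_eq, map_sub, ← S.Φ_eq, ← S.Φ_eq]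

namespace Admissible

open Set

theorem traceNorm_exp_conj_approx_le (hS : S.Admissible T) {s t η : ℝ} (ht : t ∈ Icc 0 T)
    (hs : 0 ≤ s) {e σ : Matrix (Fin m) (Fin m) ℂ}
    (he : traceNorm (NormedSpace.exp (s • S.A t) * σ * NormedSpace.exp (s • (S.A t)ᴴ) -
      e * σ * eᴴ) ≤ η * traceNorm σ) :
    traceNorm (e * σ * eᴴ) ≤ (1 + η) * traceNorm σ := by
  have h1 := traceNorm_le_add_sub (e * σ * eᴴ)
    (NormedSpace.exp (s • S.A t) * σ * NormedSpace.exp (s • (S.A t)ᴴ))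
  rw [traceNorm_sub_comm (e * σ * eᴴ)] at h1
  linarith [hS.traceNorm_exp_conj_le ht hs σ]

/-- The truncated channel factors. -/
theorem traceNorm_truncated_channelFactor (hS : S.Admissible T) {τ t ε : ℝ} (hτ : 0 ≤ τ)
    (ht : t ∈ Icc 0 T) {κ κ' : Type*} [Fintype κ] [DecidableEq κ] [Fintype κ']
    {X : Matrix (Fin m) κ ℂ} {G : Matrix (Fin m) κ' ℂ}
    (hG : IsTruncatedSVD ε (S.channelFactor τ t X) G) :
    traceNorm (τ • S.jump t (X * Xᴴ) - G * Gᴴ) ≤ ε ∧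
      traceNorm (G * Gᴴ) ≤ τ * S.C₂ T * traceNorm (X * Xᴴ) := by
  have h1 := hG.traceNorm_sub_le
  have h2 := hG.traceNorm_le
  rw [channelFactor_mul_conjTranspose hτ fun k => hS.nonneg k t ht] at h1 h2
  exact ⟨h1, h2.trans (hS.traceNorm_smul_jump_le ht hτ _)⟩

/-- The half step of the low-rank scheme approximates the one of the full-rank scheme. -/
theorem traceNorm_lowRank_halfStep (hS : S.Admissible T) {τ t ε η : ℝ} (hτ : 0 ≤ τ)
    (ht : t ∈ Icc 0 T) (hη : 0 ≤ η) {e : Matrix (Fin m) (Fin m) ℂ}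
    (he : ∀ σ, traceNorm (NormedSpace.exp ((1 / 2 * τ) • S.A t) * σ *
      NormedSpace.exp ((1 / 2 * τ) • (S.A t)ᴴ) - e * σ * eᴴ) ≤ η * traceNorm σ)
    {p a b : ℕ} {X : Matrix (Fin m) (Fin p) ℂ} {G : Matrix (Fin m) (Fin a) ℂ}
    {Xh : Matrix (Fin m) (Fin b) ℂ} (hG : IsTruncatedSVD ε (S.channelFactor τ t X) G)
    (hXh : IsTruncatedSVD ε (e * Matrix.fromCols X (√(1 / 2) • G)) Xh) :
    traceNorm (S.halfStep τ t (X * Xᴴ) - Xh * Xhᴴ) ≤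
        3 / 2 * ε + η * ((1 + τ / 2 * S.C₂ T) * traceNorm (X * Xᴴ)) ∧
      traceNorm (Xh * Xhᴴ) ≤ (1 + η) * ((1 + τ / 2 * S.C₂ T) * traceNorm (X * Xᴴ)) := by
  obtain ⟨g1, g2⟩ := hS.traceNorm_truncated_channelFactor hτ ht hG
  have h1 := hXh.traceNorm_sub_le
  have h2 := hXh.traceNorm_le
  have hτ2 : 0 ≤ 1 / 2 * τ := by positivity
  rw [mul_mul_conjTranspose_mul, fromCols_mul_conjTranspose, smul_mul_conjTranspose_smul,
    Real.sq_sqrt (by norm_num)] at h1 h2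
  set x := X * Xᴴ
  set g := G * Gᴴ
  set y := x + (1 / 2 : ℝ) • g with hy
  set E := NormedSpace.exp ((1 / 2 * τ) • S.A t) with hE
  set E' := NormedSpace.exp ((1 / 2 * τ) • (S.A t)ᴴ) with hE'
  have hy1 : traceNorm y ≤ (1 + τ / 2 * S.C₂ T) * traceNorm x := by
    have h3 := traceNorm_smul_le (1 / 2) g
    rw [abs_of_nonneg (by norm_num)] at h3
    linarith [traceNorm_add_le x ((1 / 2 : ℝ) • g)]
  have h4 : S.halfStep τ t x - E * y * E' = E * ((1 / 2 : ℝ) • (τ • S.jump t x - g)) * E' := by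
    have : x + (1 / 2 * τ) • S.jump t x - y = (1 / 2 : ℝ) • (τ • S.jump t x - g) := by
      rw [hy]
      module
    rw [← this, Matrix.mul_sub, Matrix.sub_mul, halfStep, show τ / 2 = 1 / 2 * τ by ring]
  have h5 : traceNorm (S.halfStep τ t x - E * y * E') ≤ 1 / 2 * ε := by
    rw [h4]
    refine (hS.traceNorm_exp_conj_le ht hτ2 _).trans ((traceNorm_smul_le _ _).trans ?_)
    rw [abs_of_nonneg (by norm_num)]
    gcongr
  have h6 := he y
  constructor
  -- The `3 / 2 * ε` is `ε / 2` from `G`, which enters with weight one half, plus `ε` from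
  -- compressing `Xh`.
  · have h7 := traceNorm_sub_le (S.halfStep τ t x) (E * y * E') (Xh * Xhᴴ)
    have h8 := traceNorm_sub_le (E * y * E') (e * y * eᴴ) (Xh * Xhᴴ)
    have h9 : η * traceNorm y ≤ η * ((1 + τ / 2 * S.C₂ T) * traceNorm x) := by gcongr
    linarith
  · refine h2.trans ((hS.traceNorm_exp_conj_approx_le ht hτ2 h6).trans ?_)
    gcongr

/-- The unnormalized step of the low-rank scheme approximates the full-rank one. -/
theorem traceNorm_lowRank_step (hS : S.Admissible T) {τ t ε η : ℝ} (hτ : 0 ≤ τ)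
    (ht : t ∈ Icc 0 T) (ht' : t + τ / 2 ∈ Icc 0 T) (hη : 0 ≤ η)
    {e₀ e₁ e₂ : Matrix (Fin m) (Fin m) ℂ}
    (he₀ : ∀ σ, traceNorm (NormedSpace.exp ((1 / 2 * τ) • S.A t) * σ *
      NormedSpace.exp ((1 / 2 * τ) • (S.A t)ᴴ) - e₀ * σ * e₀ᴴ) ≤ η * traceNorm σ)
    (he₁ : ∀ σ, traceNorm (NormedSpace.exp ((1 * τ) • S.A (t + τ / 2)) * σ *
      NormedSpace.exp ((1 * τ) • (S.A (t + τ / 2))ᴴ) - e₁ * σ * e₁ᴴ) ≤ η * traceNorm σ)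
    (he₂ : ∀ σ, traceNorm (NormedSpace.exp ((1 / 2 * τ) • S.A (t + τ / 2)) * σ *
      NormedSpace.exp ((1 / 2 * τ) • (S.A (t + τ / 2))ᴴ) - e₂ * σ * e₂ᴴ) ≤ η * traceNorm σ)
    {p p' a b c : ℕ} {X : Matrix (Fin m) (Fin p) ℂ} {G : Matrix (Fin m) (Fin a) ℂ}
    {Xh : Matrix (Fin m) (Fin b) ℂ} {Gh : Matrix (Fin m) (Fin c) ℂ}
    {Xhat : Matrix (Fin m) (Fin p') ℂ}
    (hG : IsTruncatedSVD ε (S.channelFactor τ t X) G)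
    (hXh : IsTruncatedSVD ε (e₀ * Matrix.fromCols X (√(1 / 2) • G)) Xh)
    (hGh : IsTruncatedSVD ε (S.channelFactor τ (t + τ / 2) Xh) Gh)
    (hXhat : IsTruncatedSVD ε (Matrix.fromCols (e₁ * X) (e₂ * Gh)) Xhat) :
    traceNorm (S.Φ τ t (X * Xᴴ) - Xhat * Xhatᴴ) ≤
        (2 + 3 / 2 * (τ * S.C₂ T)) * ε +
        η * (1 + τ * S.C₂ T * (2 + η) * (1 + τ / 2 * S.C₂ T)) * traceNorm (X * Xᴴ) ∧
      traceNorm (Xhat * Xhatᴴ) ≤ (1 + η) *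
        (1 + τ * S.C₂ T * (1 + η) * (1 + τ / 2 * S.C₂ T)) * traceNorm (X * Xᴴ) := by
  obtain ⟨k1, k2⟩ := hS.traceNorm_lowRank_halfStep hτ ht hη he₀ hG hXh
  obtain ⟨g1, g2⟩ := hS.traceNorm_truncated_channelFactor hτ ht' hGh
  have h1 := hXhat.traceNorm_sub_le
  have h2 := hXhat.traceNorm_le
  have hτ2 : 0 ≤ 1 / 2 * τ := by positivity
  have hτ1 : 0 ≤ 1 * τ := by positivity
  have hC : 0 ≤ S.C₂ T := hS.C₂_nonneg (ht.1.trans ht.2)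
  have hτC : 0 ≤ τ * S.C₂ T := mul_nonneg hτ hC
  rw [fromCols_mul_conjTranspose, mul_mul_conjTranspose_mul, mul_mul_conjTranspose_mul] at h1 h2
  set x := X * Xᴴ
  set xh := Xh * Xhᴴ
  set gh := Gh * Ghᴴ
  set xhat := Xhat * Xhatᴴ
  set hs := S.halfStep τ t x with hhs
  set E₁ := NormedSpace.exp ((1 * τ) • S.A (t + τ / 2)) with hE₁
  set E₁' := NormedSpace.exp ((1 * τ) • (S.A (t + τ / 2))ᴴ) with hE₁'
  set E₂ := NormedSpace.exp ((1 / 2 * τ) • S.A (t + τ / 2)) with hE₂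
  set E₂' := NormedSpace.exp ((1 / 2 * τ) • (S.A (t + τ / 2))ᴴ) with hE₂'
  have hΦ : S.Φ τ t x = E₁ * x * E₁' + E₂ * (τ • S.jump (t + τ / 2) hs) * E₂' := by
    rw [Φ, hE₁, hE₁', one_mul, hE₂, hE₂', show τ / 2 = 1 / 2 * τ by ring, Matrix.mul_smul,
      Matrix.smul_mul, hhs]
  have hgh : traceNorm gh ≤
      τ * S.C₂ T * ((1 + η) * ((1 + τ / 2 * S.C₂ T) * traceNorm x)) :=
    g2.trans (mul_le_mul_of_nonneg_left k2 hτC)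
  constructor
  · have j1 : traceNorm (τ • S.jump (t + τ / 2) hs - gh) ≤
        τ * S.C₂ T * (3 / 2 * ε + η * ((1 + τ / 2 * S.C₂ T) * traceNorm x)) + ε := by
      refine (traceNorm_sub_le _ (τ • S.jump (t + τ / 2) xh) _).trans (add_le_add ?_ g1)
      rw [← smul_sub, ← jump_sub]
      exact (hS.traceNorm_smul_jump_le ht' hτ _).trans (mul_le_mul_of_nonneg_left k1 hτC)
    have j2 : traceNorm (E₂ * (τ • S.jump (t + τ / 2) hs) * E₂' - E₂ * gh * E₂') ≤
        τ * S.C₂ T * (3 / 2 * ε + η * ((1 + τ / 2 * S.C₂ T) * traceNorm x)) + ε := by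
      rw [← Matrix.sub_mul, ← Matrix.mul_sub]
      exact (hS.traceNorm_exp_conj_le ht' hτ2 _).trans j1
    have j3 := he₁ x
    have j4 := (he₂ gh).trans (mul_le_mul_of_nonneg_left hgh hη)
    -- Telescoping: jump error of the half step and of `Gh`, error of the half-step exponential,
    -- error of the full-step exponential, final compression. The two compressions give `2 * ε`; the
    -- half-step error passes through the jump and gains a factor `τ * C₂`.
    have j5 : S.Φ τ t x - xhat =
        ((E₂ * (τ • S.jump (t + τ / 2) hs) * E₂' - E₂ * gh * E₂') +
          (E₂ * gh * E₂' - e₂ * gh * e₂ᴴ)) +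
        (E₁ * x * E₁' - e₁ * x * e₁ᴴ) + ((e₁ * x * e₁ᴴ + e₂ * gh * e₂ᴴ) - xhat) := by
      rw [hΦ]
      abel
    rw [j5]
    refine (traceNorm_add_le _ _).trans ((add_le_add ((traceNorm_add_le _ _).trans
      (add_le_add ((traceNorm_add_le _ _).trans (add_le_add j2 j4)) j3)) h1).trans_eq ?_)
    ring
  · have j1 := hS.traceNorm_exp_conj_approx_le ht' hτ1 (he₁ x)
    have j2 := (hS.traceNorm_exp_conj_approx_le ht' hτ2 (he₂ gh)).trans
      (mul_le_mul_of_nonneg_left hgh (by positivity))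
    refine (h2.trans ((traceNorm_add_le _ _).trans (add_le_add j1 j2))).trans_eq ?_
    ring

end Admissible

end System

/-- The exponential rate at which errors of the full-rank scheme grow. -/
def growthRate (C₂ T : ℝ) : ℝ := C₂ * (1 + T / 2 * C₂)

/-- The factor of the compression tolerance in the local error of the low-rank scheme. -/
def compressionFactor (C₂ T : ℝ) : ℝ := 2 + 3 / 2 * (T * C₂)

/-- The factor of the tolerance of the matrix exponentials in the local error of the low-rank
scheme. -/
def expFactor (C₂ Ce T : ℝ) : ℝ := Ce * (1 + T * C₂ * (2 + Ce * T) * (1 + T / 2 * C₂))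

/-! ### The normalized low-rank step -/

namespace System

open Set

variable {m K : ℕ} {S : System m K} {T : ℝ}

theorem mem_Icc_of_grid {T τ t : ℝ} {N n : ℕ} (hτ : 0 ≤ τ) (hNτ : N * τ = T)
    (hn : n < N) (ht : t = n * τ) : t ∈ Icc 0 T ∧ t + τ / 2 ∈ Icc 0 T ∧ t + τ ∈ Icc 0 T := by
  have hn' : (n : ℝ) + 1 ≤ N := by exact_mod_cast hn
  have h1 : (n + 1) * τ ≤ T := by
    rw [← hNτ]
    gcongr
  have h2 : 0 ≤ n * τ := by positivity
  rw [ht]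
  refine ⟨⟨?_, ?_⟩, ⟨?_, ?_⟩, ⟨?_, ?_⟩⟩ <;> linarith

namespace Admissible

/-- One step of the normalized low-rank scheme from a normalized, or vanishing, factor. -/
theorem step_bounds (hS : S.Admissible T) {C₁ Ce τ ϵ₁ ϵ₂ : ℝ} (hCe : 0 < Ce) (hϵ₁ : 0 < ϵ₁)
    (hϵ₂ : 0 < ϵ₂) (hτ : 0 ≤ τ) {N n : ℕ} (hNτ : N * τ = T) (hn : n < N)
    (hC₁ : ∀ t τ : ℝ, 0 ≤ τ → t ∈ Icc 0 T → t + τ ∈ Icc 0 T → ∀ X : Matrix (Fin m) (Fin m) ℂ,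
        ‖(S.Φ τ t X).trace - X.trace‖ ≤ C₁ * τ ^ 3 * traceNorm X)
    {e : ℝ → ℝ → Matrix (Fin m) (Fin m) ℂ} (he : S.IsExpApprox τ N Ce (τ * ϵ₂) e)
    {p p' : ℕ} {X : Matrix (Fin m) (Fin p) ℂ} {X' : Matrix (Fin m) (Fin p') ℂ}
    (hX : frobNorm X ^ 2 = 0 ∨ frobNorm X ^ 2 = 1)
    (hstep : S.IsLREMStep τ (τ * ϵ₁) e (n * τ) X X') :
    (frobNorm X' ^ 2 = 0 ∨ frobNorm X' ^ 2 = 1) ∧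
      (ϵ₂ ≤ 1 → 0 ≤ C₁ → traceNorm (S.Φ τ (n * τ) (X * Xᴴ) - X' * X'ᴴ) ≤
        τ * (C₁ * τ ^ 2 + 2 * compressionFactor (S.C₂ T) T * ϵ₁ +
          2 * expFactor (S.C₂ T) Ce T * ϵ₂)) := by
  obtain ⟨a, b, c, G, Xh, Gh, Xhat, hG, hXh, hGh, hXhat, rfl⟩ := hstep
  obtain ⟨ht, htm, ht'⟩ := mem_Icc_of_grid hτ hNτ hn rfl
  refine ⟨?_, fun hϵ hC₁0 => ?_⟩
  · rw [frobNorm_smul_sq]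
    by_cases h0 : frobNorm Xhat = 0
    · simp [h0]
    · right
      field_simp
  have hT : 0 ≤ T := ht.1.trans ht.2
  have hq : 0 ≤ S.C₂ T := hS.C₂_nonneg hT
  have hτT : τ ≤ T := by linarith [ht.1, ht'.2]
  set q := S.C₂ T with hqdef
  set η := Ce * (τ * ϵ₂) with hηdef
  have hη : 0 ≤ η := by positivity
  -- The only use of `ϵ₂ ≤ 1`: it bounds the `η` inside the factor of `η`, so that `expFactor` does
  -- not depend on `ϵ₂`.
  have hηT : η ≤ Ce * T := by
    rw [hηdef]
    gcongr
    exact (mul_le_of_le_one_right hτ hϵ).trans hτT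
  have hmid : ((n : ℝ) + 1 / 2) * τ = n * τ + τ / 2 := by ring
  have he' := he n hn
  have e1 := he' (1 / 2) (by simp) n (by simp)
  have e2 := he' 1 (by simp) (n + 1 / 2) (by simp)
  have e3 := he' (1 / 2) (by simp) (n + 1 / 2) (by simp)
  rw [hmid] at e2 e3
  obtain ⟨b1, b2⟩ := hS.traceNorm_lowRank_step hτ ht htm hη e1 e2 e3 hG hXh hGh hXhat
  have hp := traceNorm_mul_conjTranspose X
  rw [hp] at b1 b2
  set t : ℝ := n * τ with htdef
  have hbd : 0 ≤ compressionFactor q T * ϵ₁ + expFactor q Ce T * ϵ₂ := by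
    unfold compressionFactor expFactor
    positivity
  have hC₁τ : 0 ≤ C₁ * τ ^ 2 := by positivity
  -- Once a factor vanishes, so do all later ones, and `Φ` maps zero to zero: this step has no local
  -- error.
  rcases hX with hX0 | hX1
  · rw [hX0, mul_zero] at b2
    have hXX : X * Xᴴ = 0 := eq_zero_of_traceNorm_le_zero (hp.trans hX0).le
    have hhat0 : Xhat * Xhatᴴ = 0 := eq_zero_of_traceNorm_le_zero b2
    rw [smul_mul_conjTranspose_smul, hhat0, hXX, S.Φ_eq, map_zero, smul_zero, sub_zero,
      traceNorm_zero]
    exact mul_nonneg hτ (by linarith)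
  · rw [hX1, mul_one] at b1
    have hlocal : traceNorm (S.Φ τ t (X * Xᴴ) - Xhat * Xhatᴴ) ≤
        τ * (compressionFactor q T * ϵ₁ + expFactor q Ce T * ϵ₂) := by
      refine b1.trans ?_
      have h1 : (2 + 3 / 2 * (τ * q)) * (τ * ϵ₁) ≤ compressionFactor q T * (τ * ϵ₁) := by
        unfold compressionFactor
        gcongr
      have h2 : η * (1 + τ * q * (2 + η) * (1 + τ / 2 * q)) ≤
          η * (1 + T * q * (2 + Ce * T) * (1 + T / 2 * q)) := by
        gcongr
      calc _ ≤ compressionFactor q T * (τ * ϵ₁) +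
            η * (1 + T * q * (2 + Ce * T) * (1 + T / 2 * q)) := add_le_add h1 h2
        _ = _ := by
            rw [hηdef, expFactor]
            ring
    -- Writes the normalization defect as the trace defect of `Φ` at a matrix of unit trace, minus
    -- the trace of the local error just bounded.
    have htr : |frobNorm Xhat ^ 2 - 1| ≤
        τ * (compressionFactor q T * ϵ₁ + expFactor q Ce T * ϵ₂) + C₁ * τ ^ 3 := by
      have h1 : ((frobNorm Xhat ^ 2 - 1 : ℝ) : ℂ) =
          ((S.Φ τ t (X * Xᴴ)).trace - (X * Xᴴ).trace) -
            (S.Φ τ t (X * Xᴴ) - Xhat * Xhatᴴ).trace := by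
        rw [Matrix.trace_sub, trace_mul_conjTranspose_eq_frobNorm_sq X, hX1,
          trace_mul_conjTranspose_eq_frobNorm_sq Xhat]
        push_cast
        ring
      have h2 := hC₁ t τ hτ ht ht' (X * Xᴴ)
      rw [hp, hX1, mul_one] at h2
      rw [← Real.norm_eq_abs, ← Complex.norm_real, h1]
      refine (norm_sub_le _ _).trans ?_
      linarith [(norm_trace_le (S.Φ τ t (X * Xᴴ) - Xhat * Xhatᴴ)).trans hlocal]
    refine (traceNorm_sub_le _ (Xhat * Xhatᴴ) _).trans ((add_le_add hlocal
      ((traceNorm_sub_normalized_le Xhat).trans htr)).trans_eq ?_)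
    ring

end Admissible

end System

end LowRank

end Lindblad

end

/-! ### The global error estimate -/

theorem theorem3p3 :
    ∃ c₁ c₂ c₃ c₄ : ℝ → ℝ → ℝ → ℝ → ℝ,
      (∀ C₁ C₂ Ce T : ℝ, 0 < C₁ → 0 ≤ C₂ → 0 < Ce → 0 < T →
        0 < c₁ C₁ C₂ Ce T ∧ 0 < c₂ C₁ C₂ Ce T ∧ 0 < c₃ C₁ C₂ Ce T ∧ 0 < c₄ C₁ C₂ Ce T) ∧
      ∀ (m K : ℕ) (S : Lindblad.System m K) (T : ℝ), 0 < T → S.Admissible T →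
        ∃ C₁ : ℝ, 0 < C₁ ∧ S.IsTruncationConstant T C₁ ∧
          ∀ (ρ₀ : Matrix (Fin m) (Fin m) ℂ) (ρ : ℝ → Matrix (Fin m) (Fin m) ℂ),
            Lindblad.IsDensity ρ₀ → S.IsSolution T ρ₀ ρ →
          ∀ (Ce : ℝ), 0 < Ce →
          ∀ (N : ℕ) (τ δ ϵ₁ ϵ₂ : ℝ), 0 < N → τ = T / N → 0 < ϵ₁ → 0 < ϵ₂ →
          ∀ (e : ℝ → ℝ → Matrix (Fin m) (Fin m) ℂ) (w : ℕ → ℕ)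
            (X : (n : ℕ) → Matrix (Fin m) (Fin (w n)) ℂ),
            S.IsExpApprox τ N Ce (τ * ϵ₂) e →
            S.IsLREMRun τ (τ * ϵ₁) N e w X →
            Lindblad.traceNorm (ρ₀ - X 0 * (X 0)ᴴ) ≤ δ →
            ∀ n ≤ N,
              Lindblad.traceNorm (ρ (n * τ) - X n * (X n)ᴴ) ≤
                c₁ C₁ (S.C₂ T) Ce T * τ ^ 2 + c₂ C₁ (S.C₂ T) Ce T * δ +
                  c₃ C₁ (S.C₂ T) Ce T * ϵ₁ + c₄ C₁ (S.C₂ T) Ce T * ϵ₂ := by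
  open Lindblad System in
  -- The factors `2` count each local error once for the step and once for its normalization; in `2
  -- * C₁` the truncation error and the trace defect share one constant. The extra summand in `c₄`
  -- covers the case `ϵ₂ > 1`.
  refine ⟨fun C₁ C₂ _ T => Real.exp (T * growthRate C₂ T) * (T * (2 * C₁)),
    fun _ C₂ _ T => Real.exp (T * growthRate C₂ T),
    fun _ C₂ _ T => Real.exp (T * growthRate C₂ T) * (T * (2 * compressionFactor C₂ T)),
    fun C₁ C₂ Ce T => Real.exp (T * growthRate C₂ T) * (T * (2 * expFactor C₂ Ce T)) +
      (Real.exp (T * growthRate C₂ T) * (1 + T * (C₁ * T ^ 2)) + 1), ?_, ?_⟩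
  · intro C₁ C₂ Ce T hC₁ hC₂ hCe hT
    unfold compressionFactor expFactor
    refine ⟨?_, ?_, ?_, ?_⟩ <;> positivity
  intro m K S T hT hS
  obtain ⟨C₁, hC₁, hC₁t, htr⟩ := hS.exists_truncationConstant hT
  refine ⟨C₁, hC₁, hC₁t, ?_⟩
  intro ρ₀ ρ hρ₀ hρ Ce hCe N τ δ ϵ₁ ϵ₂ hN hτ hϵ₁ hϵ₂ e w X he hX hδ n hn
  have hq : 0 ≤ S.C₂ T := hS.C₂_nonneg hT.le
  set q := S.C₂ T with hqdef
  have hN' : (0 : ℝ) < N := by exact_mod_cast hN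
  have hτ0 : 0 ≤ τ := by rw [hτ]; positivity
  have hNτ : N * τ = T := by rw [hτ]; field_simp
  have hτT : τ ≤ T := by
    rw [← hNτ]
    exact le_mul_of_one_le_left hτ0 (by exact_mod_cast hN)
  have ha : 0 ≤ growthRate q T := by unfold growthRate; positivity
  have hb : 0 ≤ compressionFactor q T := by unfold compressionFactor; positivity
  have hc : 0 ≤ expFactor q Ce T := by unfold expFactor; positivity
  have hx : 0 ≤ τ * growthRate q T := by positivity
  have hnT : n * τ ≤ T := by
    rw [← hNτ]
    gcongr
  have hexp : Real.exp (n * (τ * growthRate q T)) ≤ Real.exp (T * growthRate q T) := by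
    rw [← mul_assoc]
    gcongr
  have hδ0 : 0 ≤ δ := (traceNorm_nonneg _).trans hδ
  have hnorm : ∀ n ≤ N, frobNorm (X n) ^ 2 = 0 ∨ frobNorm (X n) ^ 2 = 1 := by
    intro n
    induction n with
    | zero =>
      intro _
      right
      have h1 := hX.1
      rw [trace_mul_conjTranspose_eq_frobNorm_sq] at h1
      exact_mod_cast h1
    | succ n ih =>
      intro hn
      exact (hS.step_bounds hCe hϵ₁ hϵ₂ hτ0 hNτ hn htr he (ih (Nat.le_of_succ_le hn))
        (hX.2 n hn)).1
  have hΦ : ∀ n < N, ∀ Y, traceNorm (S.Φ τ (n * τ) Y) ≤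
      (1 + τ * growthRate q T) * traceNorm Y := fun n hn Y => by
    obtain ⟨h1, h2, -⟩ := mem_Icc_of_grid hτ0 hNτ hn rfl
    have hY := traceNorm_nonneg Y
    refine (hS.traceNorm_Φ_le h1 h2 hτ0 Y).trans ?_
    unfold growthRate
    gcongr
  by_cases hϵ : ϵ₂ ≤ 1
  · set y := τ * (2 * C₁ * τ ^ 2 + 2 * compressionFactor q T * ϵ₁ + 2 * expFactor q Ce T * ϵ₂)
      with hy
    have hy0 : 0 ≤ y := by positivity
    -- The error splits into the truncation error of `Φ`, the old error propagated by the linear map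
    -- `Φ`, and the local error of the low-rank step.
    have hrec := le_exp_mul_of_recurrence
      (u := fun n => traceNorm (ρ (n * τ) - X n * (X n)ᴴ)) (N := N) hx hy0 (traceNorm_nonneg _)
      (fun n hn => by
        have h1 := hC₁t ρ₀ ρ hρ₀ hρ N τ hN hτ n hn
        have h2 := hΦ n hn (ρ (n * τ) - X n * (X n)ᴴ)
        rw [Φ_sub] at h2
        have h3 := (hS.step_bounds hCe hϵ₁ hϵ₂ hτ0 hNτ hn htr he (hnorm n hn.le)
          (hX.2 n hn)).2 hϵ hC₁.le
        have h4 := traceNorm_sub_le (ρ ((n + 1) * τ)) (S.Φ τ (n * τ) (ρ (n * τ)))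
          (X (n + 1) * (X (n + 1))ᴴ)
        have h5 := traceNorm_sub_le (S.Φ τ (n * τ) (ρ (n * τ)))
          (S.Φ τ (n * τ) (X n * (X n)ᴴ)) (X (n + 1) * (X (n + 1))ᴴ)
        push_cast
        rw [hy]
        linarith) n hn
    simp only [Nat.cast_zero, zero_mul, hρ.1] at hrec
    refine hrec.trans ?_
    have h6 : (n : ℝ) * y ≤
        T * (2 * C₁ * τ ^ 2 + 2 * compressionFactor q T * ϵ₁ + 2 * expFactor q Ce T * ϵ₂) := by
      rw [hy, ← mul_assoc]
      gcongr
    have h7 : 0 ≤ traceNorm (ρ₀ - X 0 * (X 0)ᴴ) := traceNorm_nonneg _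
    have h8 : 0 ≤ (Real.exp (T * growthRate q T) * (1 + T * (C₁ * T ^ 2)) + 1) * ϵ₂ := by
      positivity
    calc _ ≤ Real.exp (T * growthRate q T) * (δ +
          T * (2 * C₁ * τ ^ 2 + 2 * compressionFactor q T * ϵ₁ + 2 * expFactor q Ce T * ϵ₂)) := by
          gcongr
      _ ≤ _ := by linarith
  -- For `ϵ₂ > 1` crude bounds suffice: `‖ϱₙ‖₁ ≤ 1` by normalization, and `‖ρ(tₙ)‖₁` is bounded by
  -- Gronwall through `Φ`, which avoids proving that the flow preserves positivity.
  · have hy0 : 0 ≤ τ * (C₁ * T ^ 2) := by positivity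
    have hrec := le_exp_mul_of_recurrence
      (u := fun n => traceNorm (ρ (n * τ))) (N := N) hx hy0 (traceNorm_nonneg _)
      (fun n hn => by
        have h1 := hC₁t ρ₀ ρ hρ₀ hρ N τ hN hτ n hn
        have h2 := hΦ n hn (ρ (n * τ))
        have h3 := traceNorm_le_add_sub (ρ ((n + 1) * τ)) (S.Φ τ (n * τ) (ρ (n * τ)))
        have h4 : C₁ * τ ^ 3 ≤ τ * (C₁ * T ^ 2) := by
          calc C₁ * τ ^ 3 = τ * (C₁ * τ ^ 2) := by ring
            _ ≤ _ := by gcongr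
        push_cast
        linarith) n hn
    simp only [Nat.cast_zero, zero_mul, hρ.1, traceNorm_of_isDensity hρ₀] at hrec
    have h5 : traceNorm (X n * (X n)ᴴ) ≤ 1 := by
      rw [traceNorm_mul_conjTranspose]
      rcases hnorm n hn with h | h <;> rw [h]
      exact zero_le_one
    have h6 : traceNorm (ρ (n * τ)) ≤ Real.exp (T * growthRate q T) * (1 + T * (C₁ * T ^ 2)) := by
      refine hrec.trans ?_
      rw [← mul_assoc (n : ℝ) τ (C₁ * T ^ 2)]
      gcongr
    have h7 := traceNorm_add_le (ρ (n * τ)) (-(X n * (X n)ᴴ))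
    rw [traceNorm_neg, ← sub_eq_add_neg] at h7
    have h8 : (Real.exp (T * growthRate q T) * (1 + T * (C₁ * T ^ 2)) + 1) * 1 ≤
        (Real.exp (T * growthRate q T) * (1 + T * (C₁ * T ^ 2)) + 1) * ϵ₂ := by
      gcongr
      exact (not_le.1 hϵ).le
    have h9 : 0 ≤ Real.exp (T * growthRate q T) * (T * (2 * C₁)) * τ ^ 2 +
        Real.exp (T * growthRate q T) * δ +
        Real.exp (T * growthRate q T) * (T * (2 * compressionFactor q T)) * ϵ₁ +
        Real.exp (T * growthRate q T) * (T * (2 * expFactor q Ce T)) * ϵ₂ := by positivity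
    beta_reduce
    linarith
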